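/- Let $Q\in\mathbb{Z}[y_1,y_2,y_3]$ be a quadratic form, let $M_Q=\left(\frac{\partial^2 Q}{\partial y_i\partial y_j}\right)_{i,j}$ be its associated integral symmetric matrix, let $\Delta_Q=\det M_Q$ be its discriminant, and let $D_Q$ be the greatest common divisor of the $2\times 2$ minors of $M_Q$. Suppose that $Q$ is non-singular ($\Delta_Q\neq 0$) and isotropic (it has a non-trivial zero in $\mathbb{Q}^3$). Then there is a quadratic Dirichlet character $\chi_Q$ (one taking values in $\{0,\pm1\}$; the principal character is allowed) such that $$\#\{\mathbf{y}\bmod p: Q(\mathbf{y})\equiv 0 \bmod p,\ p\nmid \mathbf{y}\}=p(p-1)(1+\chi_Q(p))+p-1$$ for every prime $p$ with $p\mid\Delta_Q$ and $p\nmid 2D_Q$. Moreover, for any such character $\chi_Q$ and any real numbers $w,B_1,B_2,B_3>0$, $$\#\left\{\mathbf{y}\in\mathbb{Z}^3:\ \gcd(y_1,y_2,y_3)=1,\ Q(\mathbf{y})=0,\ |y_i|\le B_i \text{ for } i=1,2,3\right\}\ll C(Q,w)\left(1+\frac{(B_1B_2B_3)^{1/3}D_Q^{1/2}}{|\Delta_Q|^{1/3}}\right),$$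 where the implied constant is absolute (in particular independent of $Q,\chi_Q,w,B_1,B_2,B_3$) and $$C(Q,w)=\prod_{\substack{p^\xi\|\Delta_Q\\ p\mid 2D_Q\text{ or }p\le w}}\tau(p^\xi)\ \prod_{\substack{p^\xi\|\Delta_Q\\ p>w,\ p\nmid 2D_Q}}\left(\sum_{k=0}^{\xi}\chi_Q(p)^k\right).$$ Here $\tau$ is the divisor function and the products run over the primes $p\mid\Delta_Q$, with $\xi\geq 1$ the exact exponent of $p$ in $\Delta_Q$. -/

import Mathlib

namespace TernaryForm

open MvPolynomial

/-- The matrix associated to a ternary quadratic form `Q ∈ ℤ[y₁,y₂,y₃]`: the integral symmetric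
matrix of second partial derivatives, so that `2 Q(y) = yᵀ M y`. (For a quadratic form the second
derivatives are constant polynomials.) -/
noncomputable def assocMatrix (Q : MvPolynomial (Fin 3) ℤ) : Matrix (Fin 3) (Fin 3) ℤ :=
  Matrix.of fun i j => constantCoeff (pderiv i (pderiv j Q))

/-- The discriminant `Δ_Q`, the determinant of the associated matrix. -/
noncomputable def discr (Q : MvPolynomial (Fin 3) ℤ) : ℤ := (assocMatrix Q).det

/-- `D_Q`, the (non-negative) greatest common divisor of the nine `2 × 2` minors of the associated
matrix; the minor indexed by `(i, j)` is obtained by deleting row `i` and column `j`. -/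
noncomputable def minorGcd (Q : MvPolynomial (Fin 3) ℤ) : ℕ :=
  Finset.univ.gcd fun ij : Fin 3 × Fin 3 =>
    ((assocMatrix Q).submatrix ij.1.succAbove ij.2.succAbove).det.natAbs

/-- `Q` is isotropic: it has a non-trivial rational zero. -/
def IsIsotropic (Q : MvPolynomial (Fin 3) ℤ) : Prop :=
  ∃ y : Fin 3 → ℚ, y ≠ 0 ∧ aeval y Q = 0

/-- The number of `y mod p` with `p ∤ y` and `Q(y) ≡ 0 mod p`. -/
noncomputable def zerosMod (Q : MvPolynomial (Fin 3) ℤ) (p : ℕ) : ℕ :=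
  {y : Fin 3 → ZMod p | y ≠ 0 ∧ aeval y Q = 0}.ncard

/-- `χ` is a quadratic Dirichlet character `χ_Q` associated to `Q`: for every prime `p` with
`p ∣ Δ_Q` and `p ∤ 2 D_Q`, the number of non-zero solutions of `Q ≡ 0` modulo `p` is
`p (p - 1) (1 + χ(p)) + p - 1`. -/
def IsAssocCharacter (Q : MvPolynomial (Fin 3) ℤ) {N : ℕ} (χ : DirichletCharacter ℤ N) : Prop :=
  MulChar.IsQuadratic χ ∧
    ∀ p : ℕ, p.Prime → (p : ℤ) ∣ discr Q → ¬ p ∣ 2 * minorGcd Q →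
      (zerosMod Q p : ℤ) = p * (p - 1) * (1 + χ (p : ZMod N)) + p - 1

open Classical in
/-- The factor `C(Q, w)`, where `p ^ ξ` exactly divides `Δ_Q` and `τ` is the divisor function:
the product of `τ(p ^ ξ)` over the primes `p ∣ Δ_Q` with `p ∣ 2 D_Q` or `p ≤ w`, times the product
of `∑_{0 ≤ k ≤ ξ} χ(p) ^ k` over the primes `p ∣ Δ_Q` with `p > w` and `p ∤ 2 D_Q`. -/
noncomputable def constC (Q : MvPolynomial (Fin 3) ℤ) {N : ℕ} (χ : DirichletCharacter ℤ N)
    (w : ℝ) : ℤ :=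
  (∏ p ∈ (discr Q).natAbs.primeFactors with p ∣ 2 * minorGcd Q ∨ (p : ℝ) ≤ w,
      (((p ^ (discr Q).natAbs.factorization p).divisors.card : ℕ) : ℤ)) *
    ∏ p ∈ (discr Q).natAbs.primeFactors with ¬ p ∣ 2 * minorGcd Q ∧ w < (p : ℝ),
      ∑ k ∈ Finset.range ((discr Q).natAbs.factorization p + 1), χ (p : ZMod N) ^ k

/-- The primitive integer zeros `y` of `Q` with `|y_i| ≤ B_i` for `i = 1, 2, 3`. -/
def primitiveZeros (Q : MvPolynomial (Fin 3) ℤ) (B : Fin 3 → ℝ) : Set (Fin 3 → ℤ) :=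
  {y | Finset.univ.gcd y = 1 ∧ eval y Q = 0 ∧ ∀ i, |(y i : ℝ)| ≤ B i}

end TernaryForm

/-!
Primitive zeros of `Q` in a box are counted class by class. If `s`, `t`, `u` are zeros of `Q` then
the Gram determinant gives `det (s, t, u) ^ 2 * Δ = 2 * β(s, t) * β(t, u) * β(s, u)`, where `β` is
the bilinear form of `M_Q`. So, when `Δ` divides `2 ^ 8 * D` times each of the three values of `β`
and `det (s, t, u) ≠ 0`, `|det (s, t, u)|` is at least of order `|Δ| / D ^ (3 / 2)`. After rescaling
the box to the unit cube, the zeros of a class lie on a conic and, read in affine charts, form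
boundedly many convex chains all of whose triangles have area `≫ r ^ 3`, where
`r = |Δ| ^ (1 / 3) / (D ^ (1 / 2) * (B₁ * B₂ * B₃) ^ (1 / 3))`. Such a chain in a square has
`≪ 1 + 1 / r` vertices.

The classes come from diagonalising `M_Q` over `ℤ_[p]` for each `p ∣ Δ`. For `p ∤ 2 * D` the form is
`a * x ^ 2 + b * y ^ 2 + p ^ ξ * c * z ^ 2` with units `a`, `b`, `c`, and the common valuation of
`x` and `y`, together with a choice of square root of `-b / a`, determines the class modulo `p ^ ξ`;
the Legendre symbol of `-a * b` is the sign in the zero count modulo `p`. These finitely many signs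
`ε p` are the values of a quadratic character: choose `m ≡ 1` modulo `4` with Jacobi symbols
`J(m | p) = ε p`, and note that `J(m | p) = J(p | m)` by quadratic reciprocity.
-/

namespace TernaryForm

section ConvexChain

variable {ι K : Type*} [LinearOrder ι] [Field K] [LinearOrder K]

/-- Twice the signed area of the triangle with vertices `(x a, y a)`, `(x b, y b)`, `(x c, y c)`. -/
def orient (x y : ι → K) (a b c : ι) : K :=
  (x b - x a) * (y c - y a) - (x c - x a) * (y b - y a)

/-- The points `(x t, y t)`, `t ∈ T`, are the vertices of a convex polygon in counterclockwise
order, and any three of them span a triangle of area at least `δ / 2`. -/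
def IsConvexChain (δ : K) (T : Finset ι) (x y : ι → K) : Prop :=
  ∀ ⦃a⦄, a ∈ T → ∀ ⦃b⦄, b ∈ T → ∀ ⦃c⦄, c ∈ T → a < b → b < c → δ ≤ orient x y a b c

variable {δ r : K} {T : Finset ι} {x y : ι → K}

lemma IsConvexChain.subset {S : Finset ι} (h : IsConvexChain δ T x y) (hS : S ⊆ T) :
    IsConvexChain δ S x y :=
  fun _ ha _ hb _ hc => h (hS ha) (hS hb) (hS hc)

lemma IsConvexChain.rotate (h : IsConvexChain δ T x y) : IsConvexChain δ T y (-x) :=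
  fun a ha b hb c hc hab hbc => (h ha hb hc hab hbc).trans_eq <| by
    simp only [orient, Pi.neg_apply]; ring

variable [IsStrictOrderedRing K]

lemma three_mul_le_add_of_cube_le {a b c r : K} (ha : 0 ≤ a) (hb : 0 ≤ b) (hc : 0 ≤ c)
    (h : r ^ 3 ≤ a * b * c) : 3 * r ≤ a + b + c := by
  have amgm : 27 * (a * b * c) ≤ (a + b + c) ^ 3 := by
    nlinarith [mul_nonneg ha (sq_nonneg (b - c)), mul_nonneg hb (sq_nonneg (a - c)),
      mul_nonneg hc (sq_nonneg (a - b)), mul_nonneg (add_nonneg (add_nonneg ha hb) hc)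
        (add_nonneg (add_nonneg (sq_nonneg (b - c)) (sq_nonneg (a - c))) (sq_nonneg (a - b)))]
  refine le_of_pow_le_pow_left₀ three_ne_zero (by positivity) ?_
  linarith [mul_pow 3 r 3]

/-- The cross product of two steps in the first quadrant is the product of their `ℓ¹` lengths and
the increment of the slope parameter `v / (u + v) ∈ [0, 1]`. -/
lemma three_mul_le_of_cube_le_cross {u v u' v' : K} (hr : 0 < r) (hu : 0 ≤ u) (hv : 0 ≤ v)
    (hu' : 0 ≤ u') (hv' : 0 ≤ v') (h : r ^ 3 ≤ u * v' - u' * v) :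
    3 * r ≤ (u + v) + (u' + v') + (v' / (u' + v') - v / (u + v)) := by
  have hcross : 0 < u * v' - u' * v := (pow_pos hr 3).trans_le h
  have hl : 0 < u + v := by
    refine (add_nonneg hu hv).lt_of_ne' fun h0 => ?_
    obtain ⟨rfl, rfl⟩ := (add_eq_zero_iff_of_nonneg hu hv).1 h0
    simp at hcross
  have hl' : 0 < u' + v' := by
    refine (add_nonneg hu' hv').lt_of_ne' fun h0 => ?_
    obtain ⟨rfl, rfl⟩ := (add_eq_zero_iff_of_nonneg hu' hv').1 h0
    simp at hcross
  have hslope : v' / (u' + v') - v / (u + v) = (u * v' - u' * v) / ((u + v) * (u' + v')) := by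
    field_simp; ring
  refine three_mul_le_add_of_cube_le hl.le hl'.le ?_ (h.trans_eq ?_) <;> rw [hslope]
  · positivity
  · field_simp

lemma card_mul_le_of_monotone_steps {x y : ℕ → K} {m : ℕ} (hr : 0 < r)
    (hx : ∀ i ≤ m, x i ≤ x (i + 1)) (hy : ∀ i ≤ m, y i ≤ y (i + 1))
    (hx1 : ∀ i ≤ m + 1, |x i| ≤ 1) (hy1 : ∀ i ≤ m + 1, |y i| ≤ 1)
    (harea : ∀ i < m, r ^ 3 ≤ orient x y i (i + 1) (i + 2)) :
    ((m : K) + 2) * r ≤ 2 * r + 3 := by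
  set u : ℕ → K := fun i => x (i + 1) - x i with hu
  set v : ℕ → K := fun i => y (i + 1) - y i with hv
  set s : ℕ → K := fun i => v i / (u i + v i)
  have hu0 : ∀ i ≤ m, 0 ≤ u i := fun i hi => sub_nonneg.2 (hx i hi)
  have hv0 : ∀ i ≤ m, 0 ≤ v i := fun i hi => sub_nonneg.2 (hy i hi)
  have htriple : ∀ i ∈ Finset.range m,
      3 * r ≤ (u i + v i) + (u (i + 1) + v (i + 1)) + (s (i + 1) - s i) := fun i hi => by
    have hi : i < m := Finset.mem_range.1 hi
    refine three_mul_le_of_cube_le_cross hr (hu0 i hi.le) (hv0 i hi.le) (hu0 _ hi) (hv0 _ hi)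
      ((harea i hi).trans_eq ?_)
    simp only [orient, hu, hv]; ring
  have hsum := Finset.sum_le_sum htriple
  have hlen : ∑ i ∈ Finset.range m, (u i + v i) = (x m - x 0) + (y m - y 0) := by
    simp only [hu, hv, Finset.sum_add_distrib, Finset.sum_range_sub]
  have hlen' : ∑ i ∈ Finset.range m, (u (i + 1) + v (i + 1)) =
      (x (m + 1) - x 1) + (y (m + 1) - y 1) := by
    simp only [hu, hv, Finset.sum_add_distrib]
    rw [Finset.sum_range_sub fun i => x (i + 1), Finset.sum_range_sub fun i => y (i + 1)]
  have hs0 : 0 ≤ s 0 :=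
    div_nonneg (hv0 0 m.zero_le) (add_nonneg (hu0 0 m.zero_le) (hv0 0 m.zero_le))
  have hsm : s m ≤ 1 := div_le_one_of_le₀ (le_add_of_nonneg_left (hu0 m le_rfl))
    (add_nonneg (hu0 m le_rfl) (hv0 m le_rfl))
  rw [Finset.sum_add_distrib, Finset.sum_add_distrib, hlen, hlen', Finset.sum_range_sub,
    Finset.sum_const, Finset.card_range, nsmul_eq_mul] at hsum
  have hb : ∀ i ≤ m + 1, (-1 ≤ x i ∧ x i ≤ 1) ∧ -1 ≤ y i ∧ y i ≤ 1 := fun i hi =>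
    ⟨abs_le.1 (hx1 i hi), abs_le.1 (hy1 i hi)⟩
  linarith [hb 0 (by lia), hb 1 (by lia), hb m (by lia), hb (m + 1) le_rfl]

lemma IsConvexChain.card_mul_le_of_monotoneOn (h : IsConvexChain (r ^ 3) T x y) (hr : 0 < r)
    (hx1 : ∀ t ∈ T, |x t| ≤ 1) (hy1 : ∀ t ∈ T, |y t| ≤ 1)
    (hx : MonotoneOn x T) (hy : MonotoneOn y T) : (T.card : K) * r ≤ 2 * r + 3 := by
  rcases lt_or_ge T.card 2 with hT | hT
  · have : (T.card : K) ≤ 2 := mod_cast hT.le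
    nlinarith
  obtain ⟨m, hm⟩ := Nat.exists_eq_add_of_le' hT
  set t : ℕ → ι := fun i => T.orderEmbOfFin hm (Fin.ofNat (m + 2) i)
  have hmem : ∀ i, t i ∈ T := fun i => T.orderEmbOfFin_mem hm _
  have hlt : ∀ i ≤ m, t i < t (i + 1) := fun i hi => by
    refine (T.orderEmbOfFin hm).strictMono ?_
    simp only [Fin.lt_def, Fin.val_ofNat]
    rw [Nat.mod_eq_of_lt (by lia), Nat.mod_eq_of_lt (by lia)]; lia
  rw [hm, Nat.cast_add, Nat.cast_two]
  exact card_mul_le_of_monotone_steps (x := x ∘ t) (y := y ∘ t) hr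
    (fun i hi => hx (hmem _) (hmem _) (hlt i hi).le)
    (fun i hi => hy (hmem _) (hmem _) (hlt i hi).le)
    (fun i _ => hx1 _ (hmem i)) (fun i _ => hy1 _ (hmem i))
    fun i hi => h (hmem _) (hmem _) (hmem _) (hlt i hi.le) (hlt (i + 1) hi)

lemma IsConvexChain.card_mul_le_of_monotoneOn_or_antitoneOn (h : IsConvexChain (r ^ 3) T x y)
    (hr : 0 < r) (hx1 : ∀ t ∈ T, |x t| ≤ 1) (hy1 : ∀ t ∈ T, |y t| ≤ 1)
    (hx : MonotoneOn x T ∨ AntitoneOn x T) (hy : MonotoneOn y T ∨ AntitoneOn y T) :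
    (T.card : K) * r ≤ 2 * r + 3 := by
  have hx1' : ∀ t ∈ T, |(-x) t| ≤ 1 := fun t ht => (abs_neg (x t)).trans_le (hx1 t ht)
  have hy1' : ∀ t ∈ T, |(-y) t| ≤ 1 := fun t ht => (abs_neg (y t)).trans_le (hy1 t ht)
  -- a suitable rotation by a multiple of a right angle makes both coordinates increasing
  rcases hx with hx | hx <;> rcases hy with hy | hy
  · exact h.card_mul_le_of_monotoneOn hr hx1 hy1 hx hy
  · have := h.rotate.rotate.rotate
    rw [neg_neg] at this
    exact this.card_mul_le_of_monotoneOn hr hy1' hx1 hy.neg hx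
  · exact h.rotate.card_mul_le_of_monotoneOn hr hy1 hx1' hy hx.neg
  · exact h.rotate.rotate.card_mul_le_of_monotoneOn hr hx1' hy1' hx.neg hy.neg

/-- The diagonals of a convex quadrilateral cross, so no line separates `a, c` from `b, d`. -/
lemma IsConvexChain.not_separated (h : IsConvexChain δ T x y) (hδ : 0 < δ) {a b c d : ι} {s : K}
    (ha : a ∈ T) (hb : b ∈ T) (hc : c ∈ T) (hd : d ∈ T) (hab : a < b) (hbc : b < c) (hcd : c < d)
    (has : x a ≤ s) (hcs : x c ≤ s) (hsb : s ≤ x b) (hsd : s ≤ x d) : False := by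
  have hbcd := hδ.trans_le (h hb hc hd hbc hcd)
  have hacd := hδ.trans_le (h ha hc hd (hab.trans hbc) hcd)
  have habd := hδ.trans_le (h ha hb hd hab (hbc.trans hcd))
  have habc := hδ.trans_le (h ha hb hc hab hbc)
  have haffine : orient x y b c d * (s - x a) + orient x y a c d * (x b - s)
      + orient x y a b d * (s - x c) + orient x y a b c * (x d - s) = 0 := by
    simp only [orient]; ring
  have ma := mul_nonneg hbcd.le (sub_nonneg.2 has)
  have mb := mul_nonneg hacd.le (sub_nonneg.2 hsb)
  have mc := mul_nonneg habd.le (sub_nonneg.2 hcs)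
  have md := mul_nonneg habc.le (sub_nonneg.2 hsd)
  have hxa : x a = s := by nlinarith
  have hxb : x b = s := by nlinarith
  have hxc : x c = s := by nlinarith
  simp [orient, hxa, hxb, hxc] at habc

lemma IsConvexChain.exists_monotone_pieces_of_lt (h : IsConvexChain δ T x y) (hδ : 0 < δ) {p q : ι}
    (hp : p ∈ T) (hq : q ∈ T) (hmin : ∀ t ∈ T, x p ≤ x t) (hmax : ∀ t ∈ T, x t ≤ x q)
    (hpq : p < q) : ∃ κ : ι → Fin 3, ∀ k,
      MonotoneOn x {t ∈ T | κ t = k} ∨ AntitoneOn x {t ∈ T | κ t = k} := by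
  refine ⟨fun t => if t < p then 0 else if t ≤ q then 1 else 2, fun k => ?_⟩
  fin_cases k
  · refine .inr fun i hi j hj hij => ?_
    have hjp : j < p := by grind
    rcases hij.eq_or_lt with rfl | hij
    · rfl
    by_contra! hlt
    exact h.not_separated hδ hi.1 hj.1 hp hq hij hjp hpq hlt.le (hmin j hj.1) le_rfl (hmax j hj.1)
  · refine .inl fun i hi j hj hij => ?_
    have hpi : p ≤ i := by grind
    have hjq : j ≤ q := by grind
    by_contra! hlt
    have hpi : p < i := hpi.lt_of_ne (by rintro rfl; exact hlt.not_ge (hmin j hj.1))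
    have hjq : j < q := hjq.lt_of_ne (by rintro rfl; exact hlt.not_ge (hmax i hi.1))
    have hij : i < j := hij.lt_of_ne (by rintro rfl; exact hlt.false)
    exact h.not_separated hδ hp hi.1 hj.1 hq hpi hij hjq (hmin i hi.1) hlt.le le_rfl (hmax i hi.1)
  · refine .inr fun i hi j hj hij => ?_
    have hqi : q < i := by grind
    rcases hij.eq_or_lt with rfl | hij
    · rfl
    by_contra! hlt
    exact h.not_separated hδ hp hq hi.1 hj.1 hpq hqi hij (hmin j hj.1) hlt.le (hmax j hj.1) le_rfl

/-- A coordinate function on a convex chain is monotone away from its two extremal points. -/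
lemma IsConvexChain.exists_monotone_pieces (h : IsConvexChain δ T x y) (hδ : 0 < δ) :
    ∃ κ : ι → Fin 3, ∀ k, MonotoneOn x {t ∈ T | κ t = k} ∨ AntitoneOn x {t ∈ T | κ t = k} := by
  rcases T.eq_empty_or_nonempty with rfl | hne
  · exact ⟨fun _ => 0, fun k => .inl (by simp [MonotoneOn])⟩
  obtain ⟨p, hp, hmin⟩ := T.exists_min_image x hne
  obtain ⟨q, hq, hmax⟩ := T.exists_max_image x hne
  rcases lt_trichotomy p q with hpq | rfl | hqp
  · exact h.exists_monotone_pieces_of_lt hδ hp hq hmin hmax hpq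
  · exact ⟨fun _ => 0, fun k => .inl fun i hi j hj _ => (hmax i hi.1).trans (hmin j hj.1)⟩
  · obtain ⟨κ, hκ⟩ := h.rotate.rotate.exists_monotone_pieces_of_lt hδ hq hp
      (fun t ht => neg_le_neg (hmax t ht)) (fun t ht => neg_le_neg (hmin t ht)) hqp
    refine ⟨κ, fun k => (hκ k).symm.imp (fun hk => ?_) fun hk => ?_⟩ <;>
      simpa only [Pi.neg_apply, neg_neg] using hk.neg

lemma card_mul_le_of_fibers {α κ : Type*} [Fintype κ] [DecidableEq κ] {T : Finset α} {f : α → κ}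
    {r B : K} (h : ∀ k, ((T.filter (f · = k)).card : K) * r ≤ B) :
    (T.card : K) * r ≤ Fintype.card κ * B := by
  rw [Finset.card_eq_sum_card_fiberwise fun t _ => Finset.mem_coe.2 (Finset.mem_univ (f t)),
    Nat.cast_sum, Finset.sum_mul]
  simpa using Finset.sum_le_card_nsmul Finset.univ _ B fun k _ => h k

lemma IsConvexChain.card_mul_le (h : IsConvexChain (r ^ 3) T x y) (hr : 0 < r)
    (hx1 : ∀ t ∈ T, |x t| ≤ 1) (hy1 : ∀ t ∈ T, |y t| ≤ 1) :
    (T.card : K) * r ≤ 9 * (2 * r + 3) := by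
  obtain ⟨κ, hκ⟩ := h.exists_monotone_pieces (pow_pos hr 3)
  obtain ⟨κ', hκ'⟩ := h.rotate.exists_monotone_pieces (pow_pos hr 3)
  suffices ∀ k, ((T.filter fun t => (κ t, κ' t) = k).card : K) * r ≤ 2 * r + 3 from
    (card_mul_le_of_fibers this).trans_eq (by norm_num [Fintype.card_prod])
  rintro ⟨k, k'⟩
  set S := T.filter fun t => (κ t, κ' t) = (k, k') with hS
  have hST : S ⊆ T := Finset.filter_subset _ _
  have hSκ : (S : Set ι) ⊆ {t : ι | t ∈ T ∧ κ t = k} := fun t ht => by simp_all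
  have hSκ' : (S : Set ι) ⊆ {t : ι | t ∈ T ∧ κ' t = k'} := fun t ht => by simp_all
  exact (h.subset hST).card_mul_le_of_monotoneOn_or_antitoneOn hr (fun t ht => hx1 t (hST ht))
    (fun t ht => hy1 t (hST ht)) ((hκ k).imp (·.mono hSκ) (·.mono hSκ))
    ((hκ' k').imp (·.mono hSκ') (·.mono hSκ'))

end ConvexChain

open Matrix

section Frames

variable {ι R : Type*} [Fintype ι] [DecidableEq ι] [CommRing R]

/-- `P.det` times the coordinates of `y` with respect to the rows of `P`. -/
def coords (P : Matrix ι ι R) (y : ι → R) : ι → R := y ᵥ* P.adjugate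

lemma coords_vecMul (P : Matrix ι ι R) (y : ι → R) : coords P y ᵥ* P = P.det • y := by
  rw [coords, vecMul_vecMul, adjugate_mul, vecMul_smul, vecMul_one]

lemma toBilin'_vecMul (M P : Matrix ι ι R) (y z : ι → R) :
    M.toBilin' (y ᵥ* P) (z ᵥ* P) = (P * M * Pᵀ).toBilin' y z := by
  simp only [toBilin'_apply', ← mulVec_transpose P z, ← dotProduct_mulVec, ← mulVec_mulVec]

lemma det_sq_mul_toBilin' (M P : Matrix ι ι R) (y z : ι → R) :
    P.det ^ 2 * M.toBilin' y z = (P * M * Pᵀ).toBilin' (coords P y) (coords P z) := by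
  rw [← toBilin'_vecMul, coords_vecMul, coords_vecMul]
  simp only [map_smul, LinearMap.smul_apply, smul_eq_mul]
  ring

lemma mul_mul_transpose_apply (M P : Matrix ι ι R) (i j : ι) :
    (P * M * Pᵀ) i j = M.toBilin' (P i) (P j) := by
  rw [mul_mul_apply, toBilin'_apply', transpose_transpose]

lemma det_mul_mul_transpose (M P : Matrix ι ι R) : (P * M * Pᵀ).det = P.det ^ 2 * M.det := by
  rw [det_mul, det_mul, det_transpose]; ring

lemma det_sq_smul_adjugate (M P : Matrix ι ι R) :
    P.det ^ 2 • M.adjugate = Pᵀ * (P * M * Pᵀ).adjugate * P := by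
  calc P.det ^ 2 • M.adjugate = (Pᵀ * adjugate Pᵀ) * adjugate M * (adjugate P * P) := by
        rw [mul_adjugate, adjugate_mul, det_transpose]
        simp [pow_two, smul_smul]
    _ = Pᵀ * (P * M * Pᵀ).adjugate * P := by
        simp only [adjugate_mul_distrib, Matrix.mul_assoc]

end Frames

section Det3

variable {R : Type*} [CommRing R]

/-- The determinant of the matrix with rows `u`, `v`, `w`. -/
def det3 (u v w : Fin 3 → R) : R := (of ![u, v, w]).det

lemma det3_eq (u v w : Fin 3 → R) : det3 u v w = u 0 * (v 1 * w 2 - v 2 * w 1)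
    + u 1 * (v 2 * w 0 - v 0 * w 2) + u 2 * (v 0 * w 1 - v 1 * w 0) := by
  simp [det3, det_fin_three]; ring

lemma det3_smul (a b c : R) (u v w : Fin 3 → R) :
    det3 (a • u) (b • v) (c • w) = a * b * c * det3 u v w := by
  simp only [det3_eq, Pi.smul_apply, smul_eq_mul]; ring

lemma det3_mul (a u v w : Fin 3 → R) :
    det3 (a * u) (a * v) (a * w) = a 0 * a 1 * a 2 * det3 u v w := by
  simp only [det3_eq, Pi.mul_apply]; ring

lemma det3_cyclic (k : Fin 3) (u v w : Fin 3 → R) :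
    det3 u v w = u k * (v (k + 1) * w (k + 2) - v (k + 2) * w (k + 1))
      + u (k + 1) * (v (k + 2) * w k - v k * w (k + 2))
      + u (k + 2) * (v k * w (k + 1) - v (k + 1) * w k) := by
  rw [det3_eq]; fin_cases k <;> simp <;> ring

end Det3

section Conic

variable {K : Type*} [Field K]

/-- The conic through `p` (at `t = 0`) and `s` (at `t = ∞`), in homogeneous coordinates. -/
def quadCurve (p q s : Fin 3 → K) (t : K) : Fin 3 → K := p + t • q + t ^ 2 • s

lemma det3_quadCurve (p q s : Fin 3 → K) (a b c : K) :
    det3 (quadCurve p q s a) (quadCurve p q s b) (quadCurve p q s c) =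
      det3 p q s * ((b - a) * (c - a) * (c - b)) := by
  simp only [det3_eq, quadCurve, Pi.add_apply, Pi.smul_apply, smul_eq_mul]; ring

lemma quadCurve_ne_zero {p q s : Fin 3 → K} (h : det3 p q s ≠ 0) (t : K) :
    quadCurve p q s t ≠ 0 := fun h0 => h <| by
  have hdet : det3 (quadCurve p q s t) q s = det3 p q s := by
    simp only [det3_eq, quadCurve, Pi.add_apply, Pi.smul_apply, smul_eq_mul]; ring
  simp [← hdet, h0, det3_eq]

lemma exists_hyperbolic_basis [NeZero (2 : K)] {M : Matrix (Fin 3) (Fin 3) K} (hM : M.IsSymm)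
    (hdet : M.det ≠ 0) {e : Fin 3 → K} (he : e ≠ 0) (hee : M.toBilin' e e = 0) :
    ∃ P : Matrix (Fin 3) (Fin 3) K, P 0 = e ∧ P.det = -1 ∧
      P * M * Pᵀ = !![0, 1, 0; 1, 0, 0; 0, 0, -M.det] := by
  have hcomm : ∀ x y, M.toBilin' x y = M.toBilin' y x := (isSymm_toBilin'_iff_isSymm.2 hM).eq
  obtain ⟨n₀, hn₀⟩ : ∃ n₀, M.toBilin' e n₀ = 1 := by
    obtain ⟨i, hi⟩ := Function.ne_iff.1 fun h => he (eq_zero_of_mulVec_eq_zero hdet h)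
    exact ⟨Pi.single i ((M *ᵥ e) i)⁻¹, by
      rw [hcomm, toBilin'_apply', single_dotProduct, inv_mul_cancel₀ hi]⟩
  set n := n₀ - (M.toBilin' n₀ n₀ / 2) • e
  have hen : M.toBilin' e n = 1 := by simp [n, hee, hn₀]
  have hnn : M.toBilin' n n = 0 := by
    simp [n, hee, hn₀, hcomm n₀ e, sub_half]
  set g := (M *ᵥ e) ⨯₃ (M *ᵥ n)
  have heg : M.toBilin' e g = 0 := by
    rw [hcomm, toBilin'_apply', dotProduct_comm, dot_self_cross]
  have hng : M.toBilin' n g = 0 := by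
    rw [hcomm, toBilin'_apply', dotProduct_comm, dot_cross_self]
  have hPdet : (of ![e, n, g]).det = -1 := by
    change Matrix.det ![e, n, g] = -1
    rw [← triple_product_eq_det, triple_product_permutation e n g, triple_product_permutation n g e]
    simp only [g, cross_dot_cross, dotProduct_comm (M *ᵥ _), ← toBilin'_apply', hee, hen, hcomm n e]
    ring
  have hform : of ![e, n, g] * M * (of ![e, n, g])ᵀ =
      !![0, 1, 0; 1, 0, 0; 0, 0, M.toBilin' g g] := by
    ext i j
    rw [mul_mul_transpose_apply]
    change M.toBilin' (![e, n, g] i) (![e, n, g] j) = _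
    fin_cases i <;> fin_cases j <;>
      simp [hee, hen, hnn, heg, hng, hcomm n e, hcomm g e, hcomm g n]
  refine ⟨of ![e, n, g], rfl, hPdet, ?_⟩
  have hgg := det_mul_mul_transpose M (of ![e, n, g])
  rw [hform, hPdet, neg_one_sq, one_mul] at hgg
  rw [hform, ← hgg]
  simp [det_fin_three]

/-- The parametrisation of a smooth conic by the lines through one of its points `e`. -/
lemma exists_quadCurve_parametrization [NeZero (2 : K)] {M : Matrix (Fin 3) (Fin 3) K}
    (hM : M.IsSymm) (hdet : M.det ≠ 0) {e : Fin 3 → K} (he : e ≠ 0) (hee : M.toBilin' e e = 0) :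
    ∃ p q s : Fin 3 → K, det3 p q s ≠ 0 ∧ ∀ y, M.toBilin' y y = 0 →
      (∃ c : K, y = c • e) ∨ ∃ c : K, c ≠ 0 ∧ ∃ t : K, y = c • quadCurve p q s t := by
  obtain ⟨P, rfl, hP, hform⟩ := exists_hyperbolic_basis hM hdet he hee
  refine ⟨P 1, P 2, (M.det / 2) • P 0, ?_, fun y hy => ?_⟩
  · have : det3 (P 1) (P 2) ((M.det / 2) • P 0) = M.det / 2 * P.det := by
      simp only [det3_eq, det_fin_three, Pi.smul_apply, smul_eq_mul]; ring
    rw [this, hP]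
    simpa [two_ne_zero] using hdet
  have hy_eq : ∀ i, y i =
      -(coords P y 0 * P 0 i + coords P y 1 * P 1 i + coords P y 2 * P 2 i) := fun i => by
    have := congrFun (coords_vecMul P y) i
    simp only [hP, vecMul, dotProduct, Fin.sum_univ_three, Pi.smul_apply, smul_eq_mul] at this
    rw [this]; ring
  have hzero : 2 * coords P y 0 * coords P y 1 = M.det * coords P y 2 ^ 2 := by
    have hquad : !![0, 1, 0; 1, 0, 0; 0, 0, -M.det].toBilin' (coords P y) (coords P y) =
        2 * coords P y 0 * coords P y 1 - M.det * coords P y 2 ^ 2 := by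
      simp [toBilin'_apply, Fin.sum_univ_three]; ring
    rw [← sub_eq_zero, ← hquad, ← hform, ← det_sq_mul_toBilin', hy, mul_zero]
  by_cases h1 : coords P y 1 = 0
  · have h2 : coords P y 2 = 0 := by simpa [h1, hdet] using hzero
    exact .inl ⟨-coords P y 0, funext fun i => by
      rw [hy_eq, h1, h2, Pi.smul_apply, smul_eq_mul]; ring⟩
  · refine .inr ⟨-coords P y 1, neg_ne_zero.2 h1, coords P y 2 / coords P y 1, funext fun i => ?_⟩
    have h0 : coords P y 0 = M.det * coords P y 2 ^ 2 / (2 * coords P y 1) := by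
      rw [eq_div_iff (mul_ne_zero two_ne_zero h1), ← hzero]; ring
    rw [hy_eq, h0]
    simp only [quadCurve, Pi.smul_apply, Pi.add_apply, smul_eq_mul]
    field_simp
    ring

end Conic

section OrderedField

variable {ι K : Type*} [Field K]

lemma orient_div_div (z : ι → Fin 3 → K) (k : Fin 3) {a b c : ι} (ha : z a k ≠ 0)
    (hb : z b k ≠ 0) (hc : z c k ≠ 0) :
    orient (fun t => z t (k + 1) / z t k) (fun t => z t (k + 2) / z t k) a b c =
      det3 (z a) (z b) (z c) / (z a k * z b k * z c k) := by
  rw [det3_cyclic k, orient]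
  field_simp
  ring

variable [LinearOrder K] [IsStrictOrderedRing K] {r : K}

lemma card_mul_le_of_cube_le_abs_det3 [LinearOrder ι] {T : Finset ι} {z : ι → Fin 3 → K} {k : Fin 3}
    (hr : 0 < r) (hk : ∀ t ∈ T, 0 < z t k) (hbox : ∀ t ∈ T, z t k ≤ 1)
    (hface : ∀ t ∈ T, ∀ i, |z t i| ≤ z t k)
    (hd : (∀ ⦃a⦄, a ∈ T → ∀ ⦃b⦄, b ∈ T → ∀ ⦃c⦄, c ∈ T → a < b → b < c →
        r ^ 3 ≤ det3 (z a) (z b) (z c)) ∨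
      ∀ ⦃a⦄, a ∈ T → ∀ ⦃b⦄, b ∈ T → ∀ ⦃c⦄, c ∈ T → a < b → b < c →
        r ^ 3 ≤ -det3 (z a) (z b) (z c)) :
    (T.card : K) * r ≤ 9 * (2 * r + 3) := by
  set x : Fin 3 → ι → K := fun i t => z t i / z t k
  have hx : ∀ i, ∀ t ∈ T, |x i t| ≤ 1 := fun i t ht => by
    rw [abs_div, abs_of_pos (hk t ht)]
    exact div_le_one_of_le₀ (hface t ht i) (hk t ht).le
  have hdiv : ∀ ⦃a⦄, a ∈ T → ∀ ⦃b⦄, b ∈ T → ∀ ⦃c⦄, c ∈ T → ∀ d : K, r ^ 3 ≤ d →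
      r ^ 3 ≤ d / (z a k * z b k * z c k) := fun a ha b hb c hc d hrd => by
    have h1 := hk a ha
    have h2 := hk b hb
    have h3 := hk c hc
    rw [le_div_iff₀ (by positivity)]
    refine (mul_le_of_le_one_right (by positivity) ?_).trans hrd
    exact mul_le_one₀ (mul_le_one₀ (hbox a ha) h2.le (hbox b hb)) h3.le (hbox c hc)
  rcases hd with hd | hd
  · refine IsConvexChain.card_mul_le (x := x (k + 1)) (y := x (k + 2)) ?_ hr (hx _) (hx _)
    intro a ha b hb c hc hab hbc
    rw [orient_div_div z k (hk a ha).ne' (hk b hb).ne' (hk c hc).ne']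
    exact hdiv ha hb hc _ (hd ha hb hc hab hbc)
  · refine IsConvexChain.card_mul_le (x := x (k + 2)) (y := x (k + 1)) ?_ hr (hx _) (hx _)
    intro a ha b hb c hc hab hbc
    have hswap : orient (x (k + 2)) (x (k + 1)) a b c = -orient (x (k + 1)) (x (k + 2)) a b c := by
      simp only [orient]; ring
    rw [hswap, orient_div_div z k (hk a ha).ne' (hk b hb).ne' (hk c hc).ne', ← neg_div]
    exact hdiv ha hb hc _ (hd ha hb hc hab hbc)

variable {T : Finset K} {p q s : Fin 3 → K} {c : K → K}

lemma card_mul_le_of_quadCurve_pos {k : Fin 3} (hpqs : det3 p q s ≠ 0) (hr : 0 < r)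
    (hc : ∀ t ∈ T, c t ≠ 0) (hk : ∀ t ∈ T, 0 < quadCurve p q s t k)
    (hface : ∀ t ∈ T, ∀ i, |quadCurve p q s t i| ≤ quadCurve p q s t k)
    (hbox : ∀ t ∈ T, ∀ i, |(c t • quadCurve p q s t) i| ≤ 1)
    (hd : ∀ ⦃t⦄, t ∈ T → ∀ ⦃u⦄, u ∈ T → ∀ ⦃v⦄, v ∈ T → t < u → u < v → r ^ 3 ≤
      |det3 (c t • quadCurve p q s t) (c u • quadCurve p q s u) (c v • quadCurve p q s v)|) :
    (T.card : K) * r ≤ 9 * (2 * r + 3) := by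
  have habs : ∀ t ∈ T, ∀ i, |c t| * |quadCurve p q s t i| ≤ 1 := fun t ht i => by
    simpa only [Pi.smul_apply, smul_eq_mul, abs_mul] using hbox t ht i
  refine card_mul_le_of_cube_le_abs_det3 (z := fun t => |c t| • quadCurve p q s t) (k := k) hr
    (fun t ht => mul_pos (abs_pos.2 (hc t ht)) (hk t ht))
    (fun t ht => (mul_le_mul_of_nonneg_left (le_abs_self _) (abs_nonneg _)).trans (habs t ht k))
    (fun t ht i => ?_) ?_
  · simp only [Pi.smul_apply, smul_eq_mul, abs_mul, abs_abs]
    exact mul_le_mul_of_nonneg_left (hface t ht i) (abs_nonneg _)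
  have hpos : ∀ ⦃t⦄, t ∈ T → ∀ ⦃u⦄, u ∈ T → ∀ ⦃v⦄, v ∈ T → t < u → u < v →
      0 < |c t| * |c u| * |c v| * ((u - t) * (v - t) * (v - u)) :=
    fun t ht u hu v hv htu huv => by
    have := hc t ht
    have := hc u hu
    have := hc v hv
    have := sub_pos.2 htu
    have := sub_pos.2 huv
    have := sub_pos.2 (htu.trans huv)
    positivity
  have hdet : ∀ t u v, det3 (|c t| • quadCurve p q s t) (|c u| • quadCurve p q s u)
      (|c v| • quadCurve p q s v) =
        det3 p q s * (|c t| * |c u| * |c v| * ((u - t) * (v - t) * (v - u))) := fun t u v => by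
    rw [det3_smul, det3_quadCurve]; ring
  have hd' : ∀ ⦃t⦄, t ∈ T → ∀ ⦃u⦄, u ∈ T → ∀ ⦃v⦄, v ∈ T → t < u → u < v → r ^ 3 ≤
      |det3 (|c t| • quadCurve p q s t) (|c u| • quadCurve p q s u) (|c v| • quadCurve p q s v)| :=
    fun t ht u hu v hv htu huv => by
      simpa only [det3_smul, abs_mul, abs_abs] using hd ht hu hv htu huv
  refine hpqs.lt_or_gt.symm.imp (fun hδ t ht u hu v hv htu huv => ?_)
    fun hδ t ht u hu v hv htu huv => ?_
  · refine (hd' ht hu hv htu huv).trans_eq (abs_of_pos ?_)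
    rw [hdet]
    exact mul_pos hδ (hpos ht hu hv htu huv)
  · refine (hd' ht hu hv htu huv).trans_eq (abs_of_neg ?_)
    rw [hdet]
    exact mul_neg_of_neg_of_pos hδ (hpos ht hu hv htu huv)

lemma card_mul_le_of_quadCurve_face {k : Fin 3} (hpqs : det3 p q s ≠ 0) (hr : 0 < r)
    (hc : ∀ t ∈ T, c t ≠ 0) (hface : ∀ t ∈ T, ∀ i, |quadCurve p q s t i| ≤ |quadCurve p q s t k|)
    (hbox : ∀ t ∈ T, ∀ i, |(c t • quadCurve p q s t) i| ≤ 1)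
    (hd : ∀ ⦃t⦄, t ∈ T → ∀ ⦃u⦄, u ∈ T → ∀ ⦃v⦄, v ∈ T → t < u → u < v → r ^ 3 ≤
      |det3 (c t • quadCurve p q s t) (c u • quadCurve p q s u) (c v • quadCurve p q s v)|) :
    (T.card : K) * r ≤ 18 * (2 * r + 3) := by
  have hk0 : ∀ t ∈ T, quadCurve p q s t k ≠ 0 := fun t ht h0 =>
    quadCurve_ne_zero hpqs t <| funext fun i => by simpa [h0] using hface t ht i
  suffices ∀ σ, ((T.filter fun t => decide (0 < quadCurve p q s t k) = σ).card : K) * r ≤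
      9 * (2 * r + 3) from
    (card_mul_le_of_fibers this).trans_eq (by norm_num [← mul_assoc])
  intro σ
  set S := T.filter fun t => decide (0 < quadCurve p q s t k) = σ
  have hST : ∀ ⦃t⦄, t ∈ S → t ∈ T := Finset.filter_subset _ _
  have hSd := fun t ht u hu v hv => hd (t := t) (hST ht) (u := u) (hST hu) (v := v) (hST hv)
  have hSσ : ∀ t ∈ S, decide (0 < quadCurve p q s t k) = σ := fun t ht =>
    (Finset.mem_filter.1 ht).2
  cases σ
  · have hneg : ∀ t, quadCurve (-p) (-q) (-s) t = -quadCurve p q s t := fun t => by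
      simp only [quadCurve, smul_neg, neg_add]
    have hdneg : det3 (-p) (-q) (-s) = -det3 p q s := by simp only [det3_eq, Pi.neg_apply]; ring
    have hlt : ∀ t ∈ S, quadCurve p q s t k < 0 := fun t ht =>
      (not_lt.1 (of_decide_eq_false (hSσ t ht))).lt_of_ne (hk0 t (hST ht))
    refine card_mul_le_of_quadCurve_pos (p := -p) (q := -q) (s := -s) (c := -c) (k := k)
      (by rwa [hdneg, neg_ne_zero]) hr (fun t ht => neg_ne_zero.2 (hc t (hST ht)))
      (fun t ht => ?_) (fun t ht i => ?_) ?_ ?_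
    · rw [hneg]
      exact neg_pos.2 (hlt t ht)
    · rw [hneg, Pi.neg_apply, Pi.neg_apply, abs_neg, ← abs_of_neg (hlt t ht)]
      exact hface t (hST ht) i
    · simpa only [hneg, Pi.neg_apply, neg_smul_neg] using fun t ht => hbox t (hST ht)
    · simpa only [hneg, Pi.neg_apply, neg_smul_neg] using hSd
  · have hgt : ∀ t ∈ S, 0 < quadCurve p q s t k := fun t ht => of_decide_eq_true (hSσ t ht)
    refine card_mul_le_of_quadCurve_pos hpqs hr (fun t ht => hc t (hST ht)) hgt
      (fun t ht i => ?_) (fun t ht => hbox t (hST ht)) hSd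
    rw [← abs_of_pos (hgt t ht)]
    exact hface t (hST ht) i

lemma card_mul_le_of_quadCurve (hpqs : det3 p q s ≠ 0) (hr : 0 < r) (hc : ∀ t ∈ T, c t ≠ 0)
    (hbox : ∀ t ∈ T, ∀ i, |(c t • quadCurve p q s t) i| ≤ 1)
    (hd : ∀ ⦃t⦄, t ∈ T → ∀ ⦃u⦄, u ∈ T → ∀ ⦃v⦄, v ∈ T → t < u → u < v → r ^ 3 ≤
      |det3 (c t • quadCurve p q s t) (c u • quadCurve p q s u) (c v • quadCurve p q s v)|) :
    (T.card : K) * r ≤ 54 * (2 * r + 3) := by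
  choose k hk using fun t => Finite.exists_max fun i => |quadCurve p q s t i|
  refine (card_mul_le_of_fibers (f := k) (B := 18 * (2 * r + 3)) fun κ => ?_).trans_eq
    (by norm_num [← mul_assoc])
  have hST : ∀ ⦃t⦄, t ∈ T.filter (k · = κ) → t ∈ T := Finset.filter_subset _ _
  refine card_mul_le_of_quadCurve_face (k := κ) hpqs hr (fun t ht => hc t (hST ht))
    (fun t ht => ?_) (fun t ht => hbox t (hST ht))
    fun t ht u hu v hv => hd (hST ht) (hST hu) (hST hv)
  rw [← (Finset.mem_filter.1 ht).2]
  exact hk t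

end OrderedField

section IntegerPoints

lemma eq_or_eq_neg_of_proportional {ι : Type*} [Fintype ι] {u v : ι → ℤ}
    (hu : Finset.univ.gcd u = 1) (hv : Finset.univ.gcd v = 1)
    (h : ∀ i j, u i * v j = u j * v i) : u = v ∨ u = -v := by
  have hdvd : ∀ {u v : ι → ℤ}, Finset.univ.gcd v = 1 → (∀ i j, u i * v j = u j * v i) →
      ∀ i, v i ∣ u i := fun {u v} hv h i => by
    have : v i ∣ Finset.univ.gcd fun j => u i * v j :=
      Finset.dvd_gcd fun j _ => h i j ▸ dvd_mul_left _ _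
    rwa [Finset.gcd_mul_left, hv, mul_one, dvd_normalize_iff] at this
  obtain ⟨i, hi⟩ : ∃ i, v i ≠ 0 := by
    by_contra! h0
    exact zero_ne_one ((Finset.gcd_eq_zero_iff.2 fun i _ => h0 i).symm.trans hv)
  have habs : (u i).natAbs = (v i).natAbs :=
    Int.natAbs_eq_of_dvd_dvd (hdvd hu (fun i j => by linarith [h i j]) i) (hdvd hv h i)
  refine (Int.natAbs_eq_natAbs_iff.1 habs).imp (fun hi' => ?_) fun hi' => ?_ <;>
    refine funext fun j => mul_left_cancel₀ hi ?_
  · linear_combination v j * hi' - h i j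
  · rw [Pi.neg_apply]
    linear_combination v j * hi' - h i j

lemma card_le_two_of_proportional {ι K : Type*} [Fintype ι] [Field K] [CharZero K]
    {X : Finset (ι → ℤ)} {e : ι → K} (hprim : ∀ y ∈ X, Finset.univ.gcd y = 1)
    (h : ∀ y ∈ X, ∃ c : K, Int.cast ∘ y = c • e) : X.card ≤ 2 := by
  classical
  rcases X.eq_empty_or_nonempty with rfl | ⟨v, hv⟩
  · simp
  suffices X ⊆ {v, -v} from (Finset.card_le_card this).trans Finset.card_le_two
  intro u hu
  obtain ⟨a, ha⟩ := h u hu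
  obtain ⟨b, hb⟩ := h v hv
  have hprop : ∀ i j, u i * v j = u j * v i := fun i j => by
    have hu' : ∀ i, (u i : K) = a * e i := congrFun ha
    have hv' : ∀ i, (v i : K) = b * e i := congrFun hb
    have : (u i * v j : K) = u j * v i := by simp only [hu', hv']; ring
    exact_mod_cast this
  simpa using eq_or_eq_neg_of_proportional (hprim u hu) (hprim v hv) hprop

variable {K : Type*} [Field K]

lemma intCast_det3 (u v w : Fin 3 → ℤ) :
    ((det3 u v w : ℤ) : K) = det3 (Int.cast ∘ u) (Int.cast ∘ v) (Int.cast ∘ w) := by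
  simp [det3_eq]

variable [LinearOrder K] [IsStrictOrderedRing K]
  {X : Finset (Fin 3 → ℤ)} {B : Fin 3 → K} {r : K}

lemma card_mul_le_of_mem_quadCurve {p q s : Fin 3 → K} {c t : (Fin 3 → ℤ) → K}
    (hpqs : det3 p q s ≠ 0) (hB : ∀ i, 0 < B i) (hr : 0 < r)
    (hprim : ∀ y ∈ X, Finset.univ.gcd y = 1) (hc : ∀ y ∈ X, c y ≠ 0)
    (hX : ∀ y ∈ X, Int.cast ∘ y = c y • quadCurve p q s (t y))
    (hbox : ∀ y ∈ X, ∀ i, |(y i : K)| ≤ B i)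
    (hd : ∀ u ∈ X, ∀ v ∈ X, ∀ w ∈ X, det3 u v w ≠ 0 →
      r ^ 3 * (B 0 * B 1 * B 2) ≤ |((det3 u v w : ℤ) : K)|) :
    (X.card : K) * r ≤ 108 * (2 * r + 3) := by
  have hcard : X.card ≤ 2 * (X.image t).card := by
    refine Finset.card_le_mul_card_image X 2 fun τ _ => ?_
    refine card_le_two_of_proportional (e := quadCurve p q s τ)
      (fun y hy => hprim y (Finset.mem_of_mem_filter y hy)) fun y hy => ?_
    obtain ⟨hyX, hτ⟩ := Finset.mem_filter.1 hy
    exact ⟨c y, hτ ▸ hX y hyX⟩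
  choose! g hgX hgt using fun τ (hτ : τ ∈ X.image t) => Finset.mem_image.1 hτ
  have hscale : ∀ t, quadCurve (B⁻¹ * p) (B⁻¹ * q) (B⁻¹ * s) t = B⁻¹ * quadCurve p q s t :=
    fun t => by simp only [quadCurve, mul_add, mul_smul_comm]
  have hpoint : ∀ τ ∈ X.image t, c (g τ) • quadCurve (B⁻¹ * p) (B⁻¹ * q) (B⁻¹ * s) τ =
      B⁻¹ * Int.cast ∘ g τ := fun τ hτ => by
    rw [hscale, hX _ (hgX τ hτ), hgt τ hτ, mul_smul_comm]
  have hB' : B⁻¹ 0 * B⁻¹ 1 * B⁻¹ 2 = (B 0 * B 1 * B 2)⁻¹ := by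
    simp only [Pi.inv_apply, mul_inv]
  have hBprod : 0 < B 0 * B 1 * B 2 := mul_pos (mul_pos (hB 0) (hB 1)) (hB 2)
  have hpqs' : det3 (B⁻¹ * p) (B⁻¹ * q) (B⁻¹ * s) ≠ 0 := by
    rw [det3_mul, hB']
    exact mul_ne_zero (inv_ne_zero hBprod.ne') hpqs
  have himage : ((X.image t).card : K) * r ≤ 54 * (2 * r + 3) := by
    refine card_mul_le_of_quadCurve (c := c ∘ g) hpqs' hr (fun τ hτ => hc _ (hgX τ hτ))
      (fun τ hτ i => ?_) fun a ha b hb d hd' hab hbd => ?_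
    · rw [Function.comp_apply, hpoint τ hτ, Pi.mul_apply, Pi.inv_apply, Function.comp_apply,
        ← div_eq_inv_mul, abs_div, abs_of_pos (hB i)]
      exact div_le_one_of_le₀ (hbox _ (hgX τ hτ) i) (hB i).le
    have hdet : det3 (g a) (g b) (g d) ≠ 0 := fun h0 => by
      have : (B 0 * B 1 * B 2)⁻¹ * ((det3 (g a) (g b) (g d) : ℤ) : K) ≠ 0 := by
        rw [intCast_det3, ← hB', ← det3_mul, ← hpoint a ha, ← hpoint b hb, ← hpoint d hd',
          det3_smul, det3_quadCurve]
        simp only [mul_ne_zero_iff, sub_ne_zero]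
        exact ⟨⟨⟨hc _ (hgX a ha), hc _ (hgX b hb)⟩, hc _ (hgX d hd')⟩, hpqs',
          ⟨hab.ne', (hab.trans hbd).ne'⟩, hbd.ne'⟩
      exact this (by rw [h0, Int.cast_zero, mul_zero])
    simp only [Function.comp_apply, hpoint a ha, hpoint b hb, hpoint d hd', det3_mul, hB',
      abs_mul, abs_inv, abs_of_pos hBprod, ← intCast_det3]
    rw [← div_eq_inv_mul, le_div_iff₀ hBprod]
    exact hd _ (hgX a ha) _ (hgX b hb) _ (hgX d hd') hdet
  have : (X.card : K) ≤ 2 * (X.image t).card := by exact_mod_cast hcard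
  linarith [mul_le_mul_of_nonneg_right this hr.le]

lemma card_mul_le_of_conic {M : Matrix (Fin 3) (Fin 3) K} (hM : M.IsSymm) (hdet : M.det ≠ 0)
    {e : Fin 3 → K} (he : e ≠ 0) (hee : M.toBilin' e e = 0) (hB : ∀ i, 0 < B i) (hr : 0 < r)
    (hprim : ∀ y ∈ X, Finset.univ.gcd y = 1)
    (hzero : ∀ y ∈ X, M.toBilin' (Int.cast ∘ y) (Int.cast ∘ y) = 0)
    (hbox : ∀ y ∈ X, ∀ i, |(y i : K)| ≤ B i)
    (hd : ∀ u ∈ X, ∀ v ∈ X, ∀ w ∈ X, det3 u v w ≠ 0 →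
      r ^ 3 * (B 0 * B 1 * B 2) ≤ |((det3 u v w : ℤ) : K)|) :
    (X.card : K) * r ≤ 218 * r + 324 := by
  classical
  obtain ⟨p, q, s, hpqs, hpar⟩ := exists_quadCurve_parametrization hM hdet he hee
  set Z := X.filter fun y => ¬ ∃ c : K, Int.cast ∘ y = c • e
  have hZX : ∀ y ∈ Z, y ∈ X := Finset.filter_subset _ _
  have hY : (X.filter fun y => ∃ c : K, Int.cast ∘ y = c • e).card ≤ 2 :=
    card_le_two_of_proportional (fun y hy => hprim y (Finset.mem_of_mem_filter y hy))
      fun y hy => (Finset.mem_filter.1 hy).2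
  choose! c hc t hX using fun y (hy : y ∈ Z) =>
    (hpar _ (hzero y (hZX y hy))).resolve_left (Finset.mem_filter.1 hy).2
  have hZ : (Z.card : K) * r ≤ 108 * (2 * r + 3) :=
    card_mul_le_of_mem_quadCurve hpqs hB hr (fun y hy => hprim y (hZX y hy)) hc hX
      (fun y hy => hbox y (hZX y hy))
      fun u hu v hv w hw => hd u (hZX u hu) v (hZX v hv) w (hZX w hw)
  have hcard : (X.card : K) ≤ 2 + Z.card := by
    rw [← Finset.card_filter_add_card_filter_not fun y => ∃ c : K, Int.cast ∘ y = c • e]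
    exact_mod_cast Nat.add_le_add_right hY _
  linarith [mul_le_mul_of_nonneg_right hcard hr.le]

end IntegerPoints

section Diagonalization

variable {ι R : Type*} [CommRing R]

lemma exists_dvd_forall [PreValuationRing R] [Finite ι] [Nonempty ι] (f : ι → R) :
    ∃ i, ∀ j, f i ∣ f j := by
  have hf : Directed (fun a b => b ∣ a) f := fun i j =>
    (ValuationRing.dvd_total (f i) (f j)).elim (fun h => ⟨i, dvd_rfl, h⟩) fun h => ⟨j, h, dvd_rfl⟩
  have : IsTrans R fun a b => b ∣ a := ⟨fun _ _ _ h h' => h'.trans h⟩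
  exact hf.finite_le id

lemma exists_forall_dvd [PreValuationRing R] [Finite ι] [Nonempty ι] (f : ι → R) :
    ∃ i, ∀ j, f j ∣ f i := by
  have hf : Directed (· ∣ ·) f := fun i j =>
    (ValuationRing.dvd_total (f i) (f j)).elim (fun h => ⟨j, h, dvd_rfl⟩) fun h => ⟨i, dvd_rfl, h⟩
  exact hf.finite_le id

variable [Fintype ι]

lemma dvd_mul_mul_apply {a : R} {M : Matrix ι ι R} (h : ∀ i j, a ∣ M i j) (P Q : Matrix ι ι R)
    (i j : ι) : a ∣ (P * M * Q) i j :=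
  Finset.dvd_sum fun _ _ => (Finset.dvd_sum fun _ _ => (h _ _).mul_left _).mul_right _

variable [DecidableEq ι]

/-- Among the values of the form at `eₖ` and `eₖ + eₗ` one divides all others, hence twice
every entry of `M` by polarisation. -/
lemma exists_pivot [PreValuationRing R] [Nonempty ι] {M : Matrix ι ι R} (hM : M.IsSymm) :
    ∃ (P : Matrix ι ι R) (k : ι), P.det = 1 ∧
      ∀ i j, (P * M * Pᵀ) k k ∣ 2 * (P * M * Pᵀ) i j := by
  set P : ι × ι → Matrix ι ι R := fun kl => if kl.1 = kl.2 then 1 else transvection kl.1 kl.2 1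
  have hP_self (k : ι) : (P (k, k) * M * (P (k, k))ᵀ) k k = M k k := by simp [P]
  have hP_ne {k l : ι} (h : k ≠ l) :
      (P (k, l) * M * (P (k, l))ᵀ) k k = M k k + M l l + 2 * M k l := by
    have hrow : P (k, l) k = Pi.single k 1 + Pi.single l 1 := by
      ext j
      simp [P, h, transvection, Matrix.single_apply, one_apply, Pi.single_apply, eq_comm]
    rw [mul_mul_transpose_apply, hrow]
    simp only [map_add, LinearMap.add_apply, toBilin'_single, hM.apply k l]
    ring
  obtain ⟨⟨k, l⟩, hkl⟩ := exists_dvd_forall fun kl => (P kl * M * (P kl)ᵀ) kl.1 kl.1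
  set a := (P (k, l) * M * (P (k, l))ᵀ) k k
  have hself (i : ι) : a ∣ M i i := by simpa only [hP_self] using hkl (i, i)
  have htwo (i j : ι) : a ∣ (2 • M) i j := by
    rw [Matrix.smul_apply, two_nsmul, ← two_mul]
    rcases eq_or_ne i j with rfl | hij
    · exact (hself i).mul_left 2
    · exact (dvd_add_right (dvd_add (hself i) (hself j))).1 (hP_ne hij ▸ hkl (i, j))
  refine ⟨P (k, l), k, ?_, fun i j => ?_⟩
  · rcases eq_or_ne k l with h | h <;> simp [P, h]
  · simpa [two_mul, two_nsmul, Matrix.mul_add, Matrix.add_mul] using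
      dvd_mul_mul_apply htwo (P (k, l)) (P (k, l))ᵀ i j

lemma exists_clear_pivot {M : Matrix (ι ⊕ Unit) (ι ⊕ Unit) R} (hM : M.IsSymm)
    (hdvd : ∀ i, M (.inr ()) (.inr ()) ∣ 2 * M (.inl i) (.inr ())) :
    ∃ (T : Matrix (ι ⊕ Unit) (ι ⊕ Unit) R) (D : Matrix ι ι R), T.det = 2 ^ Fintype.card ι ∧
      D.IsSymm ∧ T * M * Tᵀ = fromBlocks D 0 0 M.toBlocks₂₂ := by
  choose ρ hρ using hdvd
  set c : Matrix ι Unit R := of fun i _ => -ρ i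
  set T := fromBlocks (2 • (1 : Matrix ι ι R)) c 0 (1 : Matrix Unit Unit R)
  have h12 : 2 • M.toBlocks₁₂ + c * M.toBlocks₂₂ = 0 := by
    ext i ⟨⟩
    simp [c, mul_apply, toBlocks₁₂, toBlocks₂₂, hρ, mul_comm]
  have h21 : 2 • M.toBlocks₂₁ + M.toBlocks₂₂ * cᵀ = 0 := by
    ext ⟨⟩ i
    simp [c, mul_apply, toBlocks₂₁, toBlocks₂₂, hρ, hM.apply (.inl i)]
  have hform : T * M * Tᵀ =
      fromBlocks (2 • (2 • M.toBlocks₁₁ + c * M.toBlocks₂₁)) 0 0 M.toBlocks₂₂ := by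
    conv_lhs => rw [← fromBlocks_toBlocks M]
    simp only [T, fromBlocks_multiply, fromBlocks_transpose, transpose_smul, transpose_one,
      transpose_zero, Matrix.smul_mul, Matrix.mul_smul, Matrix.one_mul, Matrix.mul_one,
      Matrix.zero_mul, Matrix.mul_zero, zero_add, h12, h21, add_zero]
  have hsymm : (T * M * Tᵀ).IsSymm := by
    simp only [IsSymm, transpose_mul, transpose_transpose, hM.eq, Matrix.mul_assoc]
  refine ⟨T, _, ?_, ?_, hform⟩
  · simp [T, ← Nat.cast_smul_eq_nsmul R]
  · exact (isSymm_fromBlocks_iff.1 (hform ▸ hsymm)).1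

/-- Completing the square without dividing by `2`, which costs a factor `2 ^ (n - 1)` in the index
at the `n`-th step. -/
lemma exists_mul_mul_transpose_eq_diagonal [PreValuationRing R] {n : ℕ}
    {M : Matrix (Fin n) (Fin n) R} (hM : M.IsSymm) :
    ∃ (P : Matrix (Fin n) (Fin n) R) (d : Fin n → R),
      P * M * Pᵀ = diagonal d ∧ P.det ^ 2 = 4 ^ n.choose 2 := by
  induction n with
  | zero => exact ⟨1, 0, Subsingleton.elim _ _, by simp⟩
  | succ n ih =>
    obtain ⟨P, k, hP, hdvd⟩ := exists_pivot hM
    let e : Fin (n + 1) ≃ Fin n ⊕ Unit := (finSuccEquiv' k).trans (Equiv.optionEquivSumPUnit _)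
    have hk : e.symm (.inr ()) = k := by simp [e]
    have hN : ((P * M * Pᵀ).submatrix e.symm e.symm).IsSymm := by
      refine IsSymm.submatrix ?_ _
      simp only [IsSymm, transpose_mul, transpose_transpose, hM.eq, Matrix.mul_assoc]
    obtain ⟨T, D, hT, hD, hform⟩ := exists_clear_pivot hN fun i => by
      simpa only [submatrix_apply, hk] using hdvd _ k
    obtain ⟨Q, d, hQ, hQdet⟩ := ih hD
    set N := (P * M * Pᵀ).submatrix e.symm e.symm
    set F := fromBlocks Q 0 0 (1 : Matrix Unit Unit R)
    have hdiag : F * T * N * (F * T)ᵀ = diagonal (Sum.elim d fun i => N.toBlocks₂₂ i i) := by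
      calc F * T * N * (F * T)ᵀ = F * (T * N * Tᵀ) * Fᵀ := by
            simp only [transpose_mul, Matrix.mul_assoc]
        _ = fromBlocks (Q * D * Qᵀ) 0 0 N.toBlocks₂₂ := by
            simp [hform, F, fromBlocks_transpose, fromBlocks_multiply]
        _ = _ := by
            rw [hQ, ← fromBlocks_diagonal]
            congr
    refine ⟨(F * T).submatrix e e * P, (Sum.elim d fun i => N.toBlocks₂₂ i i) ∘ e, ?_, ?_⟩
    · calc (F * T).submatrix e e * P * M * ((F * T).submatrix e e * P)ᵀ
          = (F * T).submatrix e e * N.submatrix e e * ((F * T).submatrix e e)ᵀ := by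
            simp [N, transpose_mul, Matrix.mul_assoc]
        _ = (F * T * N * (F * T)ᵀ).submatrix e e := by
            rw [transpose_submatrix, submatrix_mul_equiv, submatrix_mul_equiv]
        _ = _ := by rw [hdiag, submatrix_diagonal_equiv]
    · rw [det_mul, det_submatrix_equiv_self, det_mul, hP, hT, det_fromBlocks_zero₂₁, mul_one,
        mul_pow, det_one, mul_one, hQdet, Fintype.card_fin, Nat.choose_succ_succ' n 1,
        Nat.choose_one_right, ← pow_mul, mul_comm n, pow_mul, pow_add]
      norm_num [mul_comm]

end Diagonalization

section OrthogonalFrame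

variable {R : Type*} [CommRing R]

lemma adjugate_diagonal_fin_three (d : Fin 3 → R) :
    (diagonal d).adjugate = diagonal ![d 1 * d 2, d 0 * d 2, d 0 * d 1] := by
  ext i j
  rw [adjugate_fin_three]
  fin_cases i <;> fin_cases j <;> simp

/-- An orthogonal basis, formed by the rows of `vectors`, of a sublattice of index `8` for the
ternary form with matrix `M`, ordered so that the last diagonal entry is divisible by the
others. -/
structure OrthogonalFrame (M : Matrix (Fin 3) (Fin 3) R) where
  vectors : Matrix (Fin 3) (Fin 3) R
  diag : Fin 3 → R
  form_eq : vectors * M * vectorsᵀ = diagonal diag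
  det_sq : vectors.det ^ 2 = 64
  dvd_last : ∀ i, diag i ∣ diag 2

lemma nonempty_orthogonalFrame [PreValuationRing R] {M : Matrix (Fin 3) (Fin 3) R}
    (hM : M.IsSymm) : Nonempty (OrthogonalFrame M) := by
  obtain ⟨P, d, hd, hdet⟩ := exists_mul_mul_transpose_eq_diagonal hM
  obtain ⟨k, hk⟩ : ∃ k, ∀ i, d i ∣ d k := exists_forall_dvd d
  let σ := Equiv.swap k 2
  refine ⟨P.submatrix σ id, d ∘ σ, ?_, ?_, fun i => by simpa [σ] using hk _⟩
  · rw [← submatrix_diagonal_equiv, ← hd]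
    rfl
  · rw [det_permute, mul_pow, hdet]
    norm_num [Nat.choose, ← Int.cast_pow, ← Units.val_pow_eq_pow_val]

namespace OrthogonalFrame

variable {M : Matrix (Fin 3) (Fin 3) R} (F : OrthogonalFrame M)

/-- `± 8` times the coordinates of `y` with respect to the frame. -/
def coord (y : Fin 3 → R) : Fin 3 → R := coords F.vectors y

include F

lemma mul_eq : F.diag 0 * F.diag 1 * F.diag 2 = 64 * M.det := by
  rw [← F.det_sq, ← det_mul_mul_transpose, F.form_eq, det_diagonal, Fin.prod_univ_three]

lemma mul_toBilin' (y z : Fin 3 → R) : 64 * M.toBilin' y z =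
    F.diag 0 * F.coord y 0 * F.coord z 0 + F.diag 1 * F.coord y 1 * F.coord z 1
      + F.diag 2 * F.coord y 2 * F.coord z 2 := by
  rw [← F.det_sq, det_sq_mul_toBilin', F.form_eq]
  simp [toBilin'_apply', dotProduct, mulVec_diagonal, Fin.sum_univ_three, coord]
  ring

lemma dvd_adjugate (i j : Fin 3) : F.diag 0 * F.diag 1 ∣ 64 * M.adjugate i j := by
  have hdiag (i j : Fin 3) : F.diag 0 * F.diag 1 ∣ (diagonal F.diag).adjugate i j := by
    rw [adjugate_diagonal_fin_three, diagonal_apply]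
    split_ifs
    · fin_cases i
      · exact mul_comm (F.diag 0) _ ▸ mul_dvd_mul_left _ (F.dvd_last 0)
      · exact mul_dvd_mul_left _ (F.dvd_last 1)
      · exact dvd_rfl
    · exact dvd_zero _
  have hadj : 64 * M.adjugate i j =
      (F.vectorsᵀ * (diagonal F.diag).adjugate * F.vectors) i j := by
    rw [← F.form_eq, ← det_sq_smul_adjugate, F.det_sq, Matrix.smul_apply, smul_eq_mul]
  exact hadj ▸ dvd_mul_mul_apply hdiag _ _ i j

lemma dvd_mul_of_dvd_adjugate {p : R} (h : ∀ i j, p ∣ M.adjugate i j) :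
    p ∣ F.diag 0 * F.diag 1 := by
  have : F.diag 0 * F.diag 1 =
      (F.vectorsᵀ.adjugate * M.adjugate * F.vectors.adjugate) 2 2 := by
    rw [Matrix.mul_assoc, ← adjugate_mul_distrib, ← adjugate_mul_distrib, F.form_eq,
      adjugate_diagonal_fin_three]
    simp
  exact this ▸ dvd_mul_mul_apply h _ _ 2 2

end OrthogonalFrame

end OrthogonalFrame

section ValuationRing

variable {R : Type*} [CommRing R]

/-- The zeros of the diagonal ternary form with coefficients `d`. -/
def diagZeros (d : Fin 3 → R) : Set (Fin 3 → R) :=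
  {t | d 0 * t 0 ^ 2 + d 1 * t 1 ^ 2 + d 2 * t 2 ^ 2 = 0}

/-- The bilinear form of `d 0 * t 0 ^ 2 + d 1 * t 1 ^ 2`; modulo `d 2` it is the bilinear form of
the diagonal ternary form with coefficients `d`. -/
def binaryBilin (d s t : Fin 3 → R) : R := d 0 * s 0 * t 0 + d 1 * s 1 * t 1

lemma dvd_two_mul_sub_or_add [PreValuationRing R] {a b g : R} (ha : IsUnit a)
    (h : g ∣ (a - b) * (a + b)) : g ∣ 2 * (a - b) ∨ g ∣ 2 * (a + b) := by
  have hsum : (a + b) + (a - b) = 2 * a := by ring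
  rcases ValuationRing.dvd_total (a - b) (a + b) with hd | hd
  · have h2 : a - b ∣ 2 := ha.dvd_mul_right.1 (hsum ▸ dvd_add hd dvd_rfl)
    exact .inr (h.trans (mul_dvd_mul_right h2 _))
  · have h2 : a + b ∣ 2 := ha.dvd_mul_right.1 (hsum ▸ dvd_add dvd_rfl hd)
    exact .inl (mul_comm 2 (a - b) ▸ h.trans (mul_dvd_mul_left _ h2))

lemma dvd_four_mul_sub {a b a' b' g : R} (h : g ∣ 2 * (a - b)) (h' : g ∣ 2 * (a' - b')) :
    g ∣ 4 * (a * a' - b * b') := by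
  have : 4 * (a * a' - b * b') = 2 * (a - b) * (2 * a') + 2 * (a' - b') * (2 * b) := by ring
  exact this ▸ dvd_add (h.mul_right _) (h'.mul_right _)

variable {d s t w : Fin 3 → R}

lemma mem_diagZeros : t ∈ diagZeros d ↔ d 0 * t 0 ^ 2 + d 1 * t 1 ^ 2 + d 2 * t 2 ^ 2 = 0 :=
  Iff.rfl

lemma dvd_add_of_mem_diagZeros (ht : t ∈ diagZeros d) : d 2 ∣ d 0 * t 0 ^ 2 + d 1 * t 1 ^ 2 :=
  ⟨-t 2 ^ 2, by linear_combination mem_diagZeros.1 ht⟩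

lemma dvd_iff_of_mem_diagZeros (ht : t ∈ diagZeros d) :
    d 2 ∣ d 0 * t 0 ^ 2 ↔ d 2 ∣ d 1 * t 1 ^ 2 :=
  ⟨fun h => (dvd_add_right h).1 (dvd_add_of_mem_diagZeros ht),
    fun h => (dvd_add_left h).1 (dvd_add_of_mem_diagZeros ht)⟩

variable [IsDomain R]

lemma associated_of_not_dvd [PreValuationRing R] (ht : t ∈ diagZeros d)
    (h : ¬ d 2 ∣ d 0 * t 0 ^ 2) : Associated (d 0 * t 0 ^ 2) (d 1 * t 1 ^ 2) := by
  have h₀ : d 0 * t 0 ^ 2 ∣ d 2 := (ValuationRing.dvd_total _ _).resolve_right h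
  have h₁ : d 1 * t 1 ^ 2 ∣ d 2 :=
    (ValuationRing.dvd_total _ _).resolve_right (mt (dvd_iff_of_mem_diagZeros ht).2 h)
  exact associated_of_dvd_dvd
    ((dvd_add_right dvd_rfl).1 (h₀.trans (dvd_add_of_mem_diagZeros ht)))
    ((dvd_add_left dvd_rfl).1 (h₁.trans (dvd_add_of_mem_diagZeros ht)))

lemma dvd_mul_mul_of_dvd_mul_sq [IsIntegrallyClosed R] {a b x y : R} (hx : a ∣ b * x ^ 2)
    (hy : a ∣ b * y ^ 2) : a ∣ b * x * y := by
  rw [← IsIntegrallyClosed.pow_dvd_pow_iff (n := 2) two_ne_zero]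
  convert mul_dvd_mul hx hy using 1 <;> ring

lemma dvd_binaryBilin [IsIntegrallyClosed R] (hs : s ∈ diagZeros d) (ht : t ∈ diagZeros d)
    (hs' : d 2 ∣ d 0 * s 0 ^ 2) (ht' : d 2 ∣ d 0 * t 0 ^ 2) : d 2 ∣ binaryBilin d s t :=
  dvd_add (dvd_mul_mul_of_dvd_mul_sq hs' ht') (dvd_mul_mul_of_dvd_mul_sq
    ((dvd_iff_of_mem_diagZeros hs).1 hs') ((dvd_iff_of_mem_diagZeros ht).1 ht'))

lemma dvd_mul_binaryBilin_iff {a b a' b' c g : R} (hw : w ∈ diagZeros d)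
    (hg : d 2 = d 0 * w 0 ^ 2 * g) (hne : d 0 * w 0 ^ 2 ≠ 0) (hs₀ : s 0 = w 0 * a)
    (hs₁ : s 1 = w 1 * b) (ht₀ : t 0 = w 0 * a') (ht₁ : t 1 = w 1 * b') :
    d 2 ∣ c * binaryBilin d s t ↔ g ∣ c * (a * a' - b * b') := by
  have : c * binaryBilin d s t =
      d 0 * w 0 ^ 2 * (c * (a * a' - b * b')) - d 2 * (c * w 2 ^ 2 * (b * b')) := by
    rw [binaryBilin, hs₀, hs₁, ht₀, ht₁]
    linear_combination c * b * b' * mem_diagZeros.1 hw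
  rw [this, dvd_sub_left (dvd_mul_right _ _), hg, mul_dvd_mul_iff_left hne]

lemma dvd_two_mul_sub_or_add_of_mem_diagZeros [PreValuationRing R] {a b g : R}
    (hs : s ∈ diagZeros d) (hw : w ∈ diagZeros d) (hg : d 2 = d 0 * w 0 ^ 2 * g)
    (hne : d 0 * w 0 ^ 2 ≠ 0) (ha : IsUnit a) (hs₀ : s 0 = w 0 * a) (hs₁ : s 1 = w 1 * b) :
    g ∣ 2 * (a - b) ∨ g ∣ 2 * (a + b) := by
  refine dvd_two_mul_sub_or_add ha ((mul_dvd_mul_iff_left hne).1 ?_)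
  rw [← hg]
  refine ⟨b ^ 2 * w 2 ^ 2 - s 2 ^ 2, ?_⟩
  have hs := mem_diagZeros.1 hs
  rw [hs₀, hs₁] at hs
  linear_combination hs - b ^ 2 * mem_diagZeros.1 hw

/-- Up to a unit, a zero whose first two coordinates are associated to those of a fixed zero `w`
is congruent to `w` with a choice of sign, and `binaryBilin d s w` detects this sign. -/
lemma dvd_four_mul_binaryBilin [PreValuationRing R] (hs : s ∈ diagZeros d) (ht : t ∈ diagZeros d)
    (hw : w ∈ diagZeros d) (hw' : ¬ d 2 ∣ d 0 * w 0 ^ 2)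
    (hs₀ : Associated (w 0) (s 0)) (hs₁ : Associated (w 1) (s 1))
    (ht₀ : Associated (w 0) (t 0)) (ht₁ : Associated (w 1) (t 1))
    (h : d 2 ∣ 2 * binaryBilin d s w ↔ d 2 ∣ 2 * binaryBilin d t w) :
    d 2 ∣ 4 * binaryBilin d s t := by
  obtain ⟨g, hg⟩ : d 0 * w 0 ^ 2 ∣ d 2 := (ValuationRing.dvd_total _ _).resolve_right hw'
  have hne : d 0 * w 0 ^ 2 ≠ 0 := fun h => hw' (h ▸ dvd_zero _)
  obtain ⟨a, ha⟩ := hs₀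
  obtain ⟨b, hb⟩ := hs₁
  obtain ⟨a', ha'⟩ := ht₀
  obtain ⟨b', hb'⟩ := ht₁
  rw [dvd_mul_binaryBilin_iff hw hg hne ha.symm hb.symm (mul_one _).symm (mul_one _).symm,
    dvd_mul_binaryBilin_iff hw hg hne ha'.symm hb'.symm (mul_one _).symm (mul_one _).symm,
    mul_one, mul_one, mul_one, mul_one] at h
  rw [dvd_mul_binaryBilin_iff hw hg hne ha.symm hb.symm ha'.symm hb'.symm]
  by_cases hsign : g ∣ 2 * ((a : R) - b)
  · exact dvd_four_mul_sub hsign (h.1 hsign)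
  · have hsum := (dvd_two_mul_sub_or_add_of_mem_diagZeros hs hw hg hne a.isUnit ha.symm
      hb.symm).resolve_left hsign
    have hsum' := (dvd_two_mul_sub_or_add_of_mem_diagZeros ht hw hg hne a'.isUnit ha'.symm
      hb'.symm).resolve_left (mt h.2 hsign)
    rw [← sub_neg_eq_add] at hsum hsum'
    simpa using dvd_four_mul_sub hsum hsum'

end ValuationRing

section PadicInt

variable {p : ℕ} [Fact p.Prime]

lemma padicInt_pow_dvd_iff {x : ℤ_[p]} {n : ℕ} (hx : x ≠ 0) :
    (p : ℤ_[p]) ^ n ∣ x ↔ n ≤ x.valuation := by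
  rw [← Ideal.mem_span_singleton, PadicInt.mem_span_pow_iff_le_valuation x hx]

lemma padicInt_associated_pow_valuation {x : ℤ_[p]} (hx : x ≠ 0) :
    Associated ((p : ℤ_[p]) ^ x.valuation) x :=
  ⟨PadicInt.unitCoeff hx, by rw [mul_comm, ← PadicInt.unitCoeff_spec hx]⟩

lemma padicInt_dvd_iff_valuation_le {x y : ℤ_[p]} (hx : x ≠ 0) (hy : y ≠ 0) :
    x ∣ y ↔ x.valuation ≤ y.valuation := by
  rw [← padicInt_pow_dvd_iff hy, (padicInt_associated_pow_valuation hx).dvd_iff_dvd_left]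

lemma padicInt_associated_iff {x y : ℤ_[p]} (hx : x ≠ 0) (hy : y ≠ 0) :
    Associated x y ↔ x.valuation = y.valuation := by
  rw [← dvd_dvd_iff_associated, padicInt_dvd_iff_valuation_le hx hy,
    padicInt_dvd_iff_valuation_le hy hx, le_antisymm_iff]

lemma padicInt_isUnit_iff {x : ℤ_[p]} : IsUnit x ↔ ¬ (p : ℤ_[p]) ∣ x := by
  rw [← Ideal.mem_span_singleton, ← PadicInt.maximalIdeal_eq_span_p,
    IsLocalRing.mem_maximalIdeal, mem_nonunits_iff, not_not]

lemma padicInt_toZMod_ne_zero_iff {x : ℤ_[p]} : PadicInt.toZMod x ≠ 0 ↔ IsUnit x := by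
  rw [padicInt_isUnit_iff, ← Ideal.mem_span_singleton, ← PadicInt.maximalIdeal_eq_span_p,
    ← PadicInt.ker_toZMod, RingHom.mem_ker]

lemma padicInt_pow_dvd_of_pow_dvd_sq {x : ℤ_[p]} {k : ℕ} (h : (p : ℤ_[p]) ^ (2 * k + 1) ∣ x ^ 2) :
    (p : ℤ_[p]) ^ (k + 1) ∣ x := by
  rcases eq_or_ne x 0 with rfl | hx
  · exact dvd_zero _
  · rw [padicInt_pow_dvd_iff (pow_ne_zero 2 hx), PadicInt.valuation_pow] at h
    rw [padicInt_pow_dvd_iff hx]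
    lia

variable {d t : Fin 3 → ℤ_[p]}

lemma isSquare_toZMod_of_not_dvd (h₀ : IsUnit (d 0)) (h₁ : IsUnit (d 1)) (ht : t ∈ diagZeros d)
    (h : ¬ d 2 ∣ d 0 * t 0 ^ 2) :
    IsSquare (-(PadicInt.toZMod (d 0) * PadicInt.toZMod (d 1))) := by
  have hassoc := associated_of_not_dvd ht h
  rw [associated_isUnit_mul_left_iff h₀, associated_isUnit_mul_right_iff h₁] at hassoc
  obtain ⟨c, hc⟩ : t 0 ∣ t 1 := (IsIntegrallyClosed.pow_dvd_pow_iff two_ne_zero).1 hassoc.dvd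
  have hdvd : d 2 ∣ (d 0 + d 1 * c ^ 2) * t 0 ^ 2 := by
    convert dvd_add_of_mem_diagZeros ht using 1
    rw [hc]
    ring
  have hunit : ¬ IsUnit (d 0 + d 1 * c ^ 2) := fun hu =>
    h ((hu.dvd_mul_left.1 hdvd).mul_left _)
  have hmod := of_not_not (mt padicInt_toZMod_ne_zero_iff.1 hunit)
  simp only [map_add, map_mul, map_pow] at hmod
  exact ⟨PadicInt.toZMod (d 1) * PadicInt.toZMod c,
    by linear_combination -PadicInt.toZMod (d 1) * hmod⟩

lemma dvd_of_odd_valuation (h₀ : IsUnit (d 0)) (h₁ : IsUnit (d 1)) (h₂ : Odd (d 2).valuation)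
    (ht : t ∈ diagZeros d) (h : d 2 ∣ d 0 * t 0 ^ 2) (i : Fin 3) : (p : ℤ_[p]) ∣ t i := by
  obtain ⟨k, hk⟩ := h₂
  have hd₂ : d 2 ≠ 0 := fun h => by simp [h] at hk
  have hassoc := padicInt_associated_pow_valuation hd₂
  rw [hk] at hassoc
  have ht₀ : (p : ℤ_[p]) ^ (k + 1) ∣ t 0 := padicInt_pow_dvd_of_pow_dvd_sq
    (hassoc.dvd.trans (h₀.dvd_mul_left.1 h))
  have ht₁ : (p : ℤ_[p]) ^ (k + 1) ∣ t 1 := padicInt_pow_dvd_of_pow_dvd_sq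
    (hassoc.dvd.trans (h₁.dvd_mul_left.1 ((dvd_iff_of_mem_diagZeros ht).1 h)))
  have ht₂ : (p : ℤ_[p]) ^ (2 * k + 1) * p ∣ p ^ (2 * k + 1) * t 2 ^ 2 := by
    rw [(hassoc.mul_right _).dvd_iff_dvd_right,
      show (p : ℤ_[p]) ^ (2 * k + 1) * p = (p ^ (k + 1)) ^ 2 by ring,
      show d 2 * t 2 ^ 2 = -(d 0 * t 0 ^ 2 + d 1 * t 1 ^ 2) by
        linear_combination mem_diagZeros.1 ht]
    exact (dvd_add ((pow_dvd_pow_of_dvd ht₀ 2).mul_left _)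
      ((pow_dvd_pow_of_dvd ht₁ 2).mul_left _)).neg_right
  have hpp : (p : ℤ_[p]) ∣ p ^ (k + 1) := dvd_pow_self _ k.succ_ne_zero
  fin_cases i
  · exact hpp.trans ht₀
  · exact hpp.trans ht₁
  · exact PadicInt.prime_p.dvd_of_dvd_pow
      ((mul_dvd_mul_iff_left (pow_ne_zero _ PadicInt.prime_p.ne_zero)).1 ht₂)

lemma valuation_of_not_dvd (hd : ∀ i, d i ≠ 0) (ht : t ∈ diagZeros d)
    (h : ¬ d 2 ∣ d 0 * t 0 ^ 2) :
    t 0 ≠ 0 ∧ t 1 ≠ 0 ∧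
      (d 0).valuation + 2 * (t 0).valuation = (d 1).valuation + 2 * (t 1).valuation ∧
      (d 1).valuation + 2 * (t 1).valuation < (d 2).valuation := by
  have h0 : t 0 ≠ 0 := fun h0 => h (by simp [h0])
  have h' := mt (dvd_iff_of_mem_diagZeros ht).2 h
  have h1 : t 1 ≠ 0 := fun h1 => h' (by simp [h1])
  have hx : d 0 * t 0 ^ 2 ≠ 0 := mul_ne_zero (hd 0) (pow_ne_zero 2 h0)
  have hy : d 1 * t 1 ^ 2 ≠ 0 := mul_ne_zero (hd 1) (pow_ne_zero 2 h1)
  have hassoc := (padicInt_associated_iff hx hy).1 (associated_of_not_dvd ht h)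
  rw [padicInt_dvd_iff_valuation_le (hd 2) hy, not_le] at h'
  rw [PadicInt.valuation_mul (hd 1) (pow_ne_zero 2 h1), PadicInt.valuation_pow] at hassoc h'
  rw [PadicInt.valuation_mul (hd 0) (pow_ne_zero 2 h0), PadicInt.valuation_pow] at hassoc
  exact ⟨h0, h1, hassoc, h'⟩

lemma exists_sign_class (hd : ∀ i, d i ≠ 0) (n : ℕ) : ∃ S : Set (Fin 3 → ℤ_[p]),
    ∀ s ∈ diagZeros d, ∀ t ∈ diagZeros d, ¬ d 2 ∣ d 0 * s 0 ^ 2 → ¬ d 2 ∣ d 0 * t 0 ^ 2 →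
      (s 1).valuation = n → (t 1).valuation = n → (s ∈ S ↔ t ∈ S) →
      d 2 ∣ 4 * binaryBilin d s t := by
  by_cases hw : ∃ w ∈ diagZeros d, ¬ d 2 ∣ d 0 * w 0 ^ 2 ∧ (w 1).valuation = n
  swap
  · exact ⟨∅, fun s hs _ _ hs' _ hsn _ _ => absurd ⟨s, hs, hs', hsn⟩ hw⟩
  obtain ⟨w, hw, hw', hwn⟩ := hw
  obtain ⟨hw₀, hw₁, hwv, -⟩ := valuation_of_not_dvd hd hw hw'
  have hassoc (s : Fin 3 → ℤ_[p]) (hs : s ∈ diagZeros d) (hs' : ¬ d 2 ∣ d 0 * s 0 ^ 2)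
      (hsn : (s 1).valuation = n) : Associated (w 0) (s 0) ∧ Associated (w 1) (s 1) := by
    obtain ⟨hs₀, hs₁, hsv, -⟩ := valuation_of_not_dvd hd hs hs'
    rw [padicInt_associated_iff hw₀ hs₀, padicInt_associated_iff hw₁ hs₁]
    lia
  refine ⟨{s | d 2 ∣ 2 * binaryBilin d s w}, fun s hs t ht hs' ht' hsn htn h => ?_⟩
  exact dvd_four_mul_binaryBilin hs ht hw hw' (hassoc s hs hs' hsn).1 (hassoc s hs hs' hsn).2
    (hassoc t ht ht' htn).1 (hassoc t ht ht' htn).2 h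

/-- The class of a zero records the valuation of `t 1` and a sign as long as `d 2` does not
divide `d 0 * t 0 ^ 2`; all other zeros form one further class. -/
lemma exists_zero_classes (hd : ∀ i, d i ≠ 0) : ∃ c : (Fin 3 → ℤ_[p]) → ℕ,
    (∀ s ∈ diagZeros d, ∀ t ∈ diagZeros d, c s = c t → d 2 ∣ 4 * binaryBilin d s t) ∧
    ∀ t ∈ diagZeros d, c t ≤ 2 * (((d 2).valuation - (d 1).valuation + 1) / 2) ∧
      (c t = 2 * (((d 2).valuation - (d 1).valuation + 1) / 2) ↔ d 2 ∣ d 0 * t 0 ^ 2) := by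
  classical
  choose S hS using exists_sign_class hd
  set m := ((d 2).valuation - (d 1).valuation + 1) / 2
  set c : (Fin 3 → ℤ_[p]) → ℕ := fun t =>
    if d 2 ∣ d 0 * t 0 ^ 2 then 2 * m else Nat.bit (t ∈ S (t 1).valuation) (t 1).valuation
  have hc_pos {t} (h : d 2 ∣ d 0 * t 0 ^ 2) : c t = 2 * m := if_pos h
  have hc_neg {t} (h : ¬ d 2 ∣ d 0 * t 0 ^ 2) :
    c t = Nat.bit (t ∈ S (t 1).valuation) (t 1).valuation := if_neg h
  have hc_lt {t} (ht : t ∈ diagZeros d) (h : ¬ d 2 ∣ d 0 * t 0 ^ 2) : c t < 2 * m := by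
    rw [hc_neg h, Nat.bit_val]
    have := (valuation_of_not_dvd hd ht h).2.2.2
    have := Bool.toNat_le (t ∈ S (t 1).valuation)
    lia
  refine ⟨c, fun s hs t ht hst => ?_, fun t ht => ?_⟩
  · by_cases hs' : d 2 ∣ d 0 * s 0 ^ 2 <;> by_cases ht' : d 2 ∣ d 0 * t 0 ^ 2
    · exact (dvd_binaryBilin hs ht hs' ht').mul_left 4
    · exact absurd (hst.symm.trans (hc_pos hs')) (hc_lt ht ht').ne
    · exact absurd (hst.trans (hc_pos ht')) (hc_lt hs hs').ne
    · rw [hc_neg hs', hc_neg ht'] at hst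
      have hval : (s 1).valuation = (t 1).valuation := by simpa using congrArg Nat.div2 hst
      refine hS _ s hs t ht hs' ht' hval rfl ?_
      simpa [hval] using congrArg Nat.bodd hst
  · by_cases h : d 2 ∣ d 0 * t 0 ^ 2
    · simp [hc_pos h, h]
    · simp [(hc_lt ht h).le, (hc_lt ht h).ne, h]

end PadicInt

section AssocMatrix

open MvPolynomial

lemma assocMatrix_isSymm (Q : MvPolynomial (Fin 3) ℤ) : (assocMatrix Q).IsSymm := by
  refine .ext fun i j => ?_
  have hcomm : ⁅(pderiv j : Derivation ℤ (MvPolynomial (Fin 3) ℤ) (MvPolynomial (Fin 3) ℤ)),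
      (pderiv i : Derivation ℤ (MvPolynomial (Fin 3) ℤ) (MvPolynomial (Fin 3) ℤ))⁆ = 0 :=
    derivation_ext fun k => by
      simp [Derivation.commutator_apply, pderiv_X, Pi.single_apply, apply_ite]
  have h := DFunLike.congr_fun hcomm Q
  rw [Derivation.commutator_apply] at h
  exact congrArg constantCoeff (sub_eq_zero.1 h)

lemma aeval_pderiv {Q : MvPolynomial (Fin 3) ℤ} (hQ : Q.IsHomogeneous 2) {R : Type*}
    [CommRing R] (y : Fin 3 → R) (i : Fin 3) :
    aeval y (pderiv i Q) = ((assocMatrix Q).map (Int.castRingHom R) *ᵥ y) i := by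
  have hQi : (pderiv i Q).IsHomogeneous 1 := hQ.pderiv
  have hconst (j : Fin 3) : pderiv j (pderiv i Q) = C (assocMatrix Q i j) := by
    have h : (pderiv j (pderiv i Q)).IsHomogeneous 0 := hQi.pderiv
    rw [← totalDegree_zero_iff_isHomogeneous, totalDegree_eq_zero_iff_eq_C] at h
    rw [h, ← (assocMatrix_isSymm Q).apply i j]
    rfl
  rw [← one_smul ℕ (pderiv i Q), ← hQi.sum_X_mul_pderiv, map_sum]
  simp [hconst, mulVec, dotProduct, mul_comm]

lemma two_mul_aeval {Q : MvPolynomial (Fin 3) ℤ} (hQ : Q.IsHomogeneous 2) {R : Type*}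
    [CommRing R] (y : Fin 3 → R) :
    2 * aeval y Q = ((assocMatrix Q).map (Int.castRingHom R)).toBilin' y y := by
  have euler := congrArg (aeval y) hQ.sum_X_mul_pderiv
  rw [map_sum, map_nsmul, nsmul_eq_mul, Nat.cast_ofNat] at euler
  rw [← euler, toBilin'_apply', dotProduct]
  simp only [map_mul, aeval_X, aeval_pderiv hQ]

lemma toBilin'_eq_zero_of_eval {Q : MvPolynomial (Fin 3) ℤ} (hQ : Q.IsHomogeneous 2)
    {y : Fin 3 → ℤ} (hy : eval y Q = 0) : (assocMatrix Q).toBilin' y y = 0 := by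
  have h := two_mul_aeval hQ y
  rw [aeval_eq_eval, hy, mul_zero] at h
  exact h.symm

lemma associated_adjugate_minor {R : Type*} [CommRing R] (M : Matrix (Fin 3) (Fin 3) R)
    (i j : Fin 3) :
    Associated (M.adjugate i j) (M.submatrix j.succAbove i.succAbove).det := by
  rw [adjugate_fin_succ_eq_det_submatrix]
  exact associated_unit_mul_left _ _ (isUnit_neg_one.pow _)

lemma dvd_mul_minorGcd_iff {Q : MvPolynomial (Fin 3) ℤ} {k m : ℕ} :
    k ∣ m * minorGcd Q ↔ ∀ i j, (k : ℤ) ∣ m * (assocMatrix Q).adjugate i j := by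
  rw [minorGcd, ← normalize_eq m, ← Finset.gcd_mul_left, Finset.dvd_gcd_iff]
  simp only [Finset.mem_univ, true_imp_iff, Prod.forall, normalize_eq]
  rw [forall_comm]
  refine forall₂_congr fun i j => ?_
  rw [((associated_adjugate_minor _ i j).mul_left _).dvd_iff_dvd_right, Int.natCast_dvd,
    Int.natAbs_mul, Int.natAbs_natCast]

lemma minorGcd_ne_zero {Q : MvPolynomial (Fin 3) ℤ} (hΔ : discr Q ≠ 0) : minorGcd Q ≠ 0 := by
  intro h
  have hadj : (assocMatrix Q).adjugate = 0 := by
    ext i j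
    simpa using dvd_mul_minorGcd_iff (k := 0) (m := 1).1 (by simp [h]) i j
  have hdet := det_adjugate (assocMatrix Q)
  rw [hadj, det_zero] at hdet
  exact pow_ne_zero _ hΔ hdet.symm

end AssocMatrix

section FiniteField

variable {F : Type*} [Field F] [Fintype F] [DecidableEq F]

lemma card_binary_zeros (hF : ringChar F ≠ 2) {a : F} (ha : a ≠ 0) (b : F) :
    ({t : F × F | a * t.1 ^ 2 + b * t.2 ^ 2 = 0}.ncard : ℤ) =
      1 + (Fintype.card F - 1) * (1 + quadraticChar F (-(a * b))) := by
  have hfiber (y : F) : ((Finset.univ.filter fun x => a * x ^ 2 + b * y ^ 2 = 0).card : ℤ) =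
      if y = 0 then 1 else 1 + quadraticChar F (-(a * b)) := by
    have hsq : (Finset.univ.filter fun x => a * x ^ 2 + b * y ^ 2 = 0) =
        {x : F | x ^ 2 = -(a * b) * (y / a) ^ 2}.toFinset := by
      ext x
      simp only [Finset.mem_filter, Finset.mem_univ, true_and, Set.mem_toFinset,
        Set.mem_ofPred_eq]
      field_simp
      rw [add_eq_zero_iff_eq_neg, mul_comm a]
    rw [hsq, quadraticChar_card_sqrts hF]
    split_ifs with hy
    · simp [hy]
    · rw [map_mul, map_pow, quadraticChar_sq_one (div_ne_zero hy ha), mul_one, add_comm]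
  have hsum : {t : F × F | a * t.1 ^ 2 + b * t.2 ^ 2 = 0}.ncard =
      ∑ y : F, (Finset.univ.filter fun x => a * x ^ 2 + b * y ^ 2 = 0).card := by
    rw [Set.ncard_eq_toFinset_card', Set.toFinset_ofPred]
    simp only [Finset.card_filter]
    rw [← Finset.univ_product_univ, Finset.sum_product_right]
  rw [hsum, Nat.cast_sum, Finset.sum_congr rfl fun y _ => hfiber y,
    ← Finset.add_sum_erase _ _ (Finset.mem_univ 0), if_pos rfl,
    Finset.sum_congr rfl fun y hy => if_neg (Finset.ne_of_mem_erase hy), Finset.sum_const,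
    Finset.card_erase_of_mem (Finset.mem_univ _), Finset.card_univ, nsmul_eq_mul,
    Nat.cast_sub Fintype.card_pos, Nat.cast_one]

lemma ncard_toBilin'_zeros (hF : ringChar F ≠ 2) {N P : Matrix (Fin 3) (Fin 3) F}
    (hP : IsUnit P) {d : Fin 3 → F} (hd : P * N * Pᵀ = diagonal d) (hd₀ : d 0 ≠ 0)
    (hd₂ : d 2 = 0) :
    ({y | N.toBilin' y y = 0}.ncard : ℤ) = Fintype.card F *
      (1 + (Fintype.card F - 1) * (1 + quadraticChar F (-(d 0 * d 1)))) := by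
  let φ : (F × F) × F → Fin 3 → F := fun t => ![t.1.1, t.1.2, t.2] ᵥ* P
  have hinj : φ.Injective := fun s t hst => by
    have h := vecMul_injective_iff_isUnit.2 hP hst
    exact Prod.ext (Prod.ext (congrFun h 0) (congrFun h 1)) (congrFun h 2)
  have hsurj : φ.Surjective := fun y => by
    obtain ⟨z, rfl⟩ := vecMul_surjective_iff_isUnit.2 hP y
    exact ⟨((z 0, z 1), z 2), congrArg (· ᵥ* P) (List.ofFn_inj.1 rfl)⟩
  have hpre : φ ⁻¹' {y | N.toBilin' y y = 0} =
      {t : F × F | d 0 * t.1 ^ 2 + d 1 * t.2 ^ 2 = 0} ×ˢ Set.univ := by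
    ext t
    simp only [φ, Set.mem_preimage, Set.mem_ofPred_eq, toBilin'_vecMul, hd, Set.mem_prod,
      Set.mem_univ, and_true]
    simp [toBilin'_apply', dotProduct, mulVec_diagonal, Fin.sum_univ_three, hd₂]
    ring_nf
  rw [← Set.image_preimage_eq {y | N.toBilin' y y = 0} hsurj,
    Set.ncard_image_of_injective _ hinj, hpre, Set.ncard_prod, Set.ncard_univ,
    Nat.card_eq_fintype_card, Nat.cast_mul, card_binary_zeros hF hd₀, mul_comm]

end FiniteField

open MvPolynomial in
lemma zerosMod_eq {Q : MvPolynomial (Fin 3) ℤ} (hQ : Q.IsHomogeneous 2) {p : ℕ} [Fact p.Prime]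
    (hp : p ≠ 2) {P : Matrix (Fin 3) (Fin 3) (ZMod p)} (hP : IsUnit P) {d : Fin 3 → ZMod p}
    (hd : P * (assocMatrix Q).map (Int.castRingHom (ZMod p)) * Pᵀ = diagonal d) (hd₀ : d 0 ≠ 0)
    (hd₂ : d 2 = 0) : (zerosMod Q p : ℤ) =
      p * (p - 1) * (1 + quadraticChar (ZMod p) (-(d 0 * d 1))) + p - 1 := by
  have hchar : ringChar (ZMod p) ≠ 2 := by rwa [ZMod.ringChar_zmod_n]
  have hbilin : {y : Fin 3 → ZMod p | aeval y Q = 0} =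
      {y | ((assocMatrix Q).map (Int.castRingHom (ZMod p))).toBilin' y y = 0} := by
    ext y
    rw [Set.mem_ofPred_eq, Set.mem_ofPred_eq, ← two_mul_aeval hQ, mul_eq_zero,
      or_iff_right (Ring.two_ne_zero hchar)]
  have hzero : zerosMod Q p + 1 = {y : Fin 3 → ZMod p | aeval y Q = 0}.ncard := by
    rw [← Set.ncard_sdiff_singleton_add_one (a := 0) (by simp [hbilin]), zerosMod]
    congr 2
    ext y
    simp [and_comm]
  have hcard := ncard_toBilin'_zeros hchar hP hd hd₀ hd₂
  rw [← hbilin, ← hzero, ZMod.card] at hcard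
  push_cast at hcard
  linear_combination hcard

section OrthogonalFrame

variable {R : Type*} [CommRing R] {M : Matrix (Fin 3) (Fin 3) R}

namespace OrthogonalFrame

variable (F : OrthogonalFrame M)

section Domain

variable [IsDomain R] [CharZero R]

lemma diag_ne_zero (hM : M.det ≠ 0) (i : Fin 3) : F.diag i ≠ 0 := by
  have h : F.diag 0 * F.diag 1 * F.diag 2 ≠ 0 :=
    F.mul_eq ▸ mul_ne_zero (OfNat.ofNat_ne_zero 64) hM
  rw [mul_ne_zero_iff, mul_ne_zero_iff] at h
  fin_cases i
  exacts [h.1.1, h.1.2, h.2]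

lemma det_dvd_of_dvd_binaryBilin {g : R} {y z : Fin 3 → R} (hg : F.diag 0 * F.diag 1 ∣ 64 * g)
    (h : F.diag 2 ∣ 4 * binaryBilin F.diag (F.coord y) (F.coord z)) :
    M.det ∣ 2 ^ 8 * g * M.toBilin' y z := by
  have hyz : F.diag 2 ∣ 2 ^ 8 * M.toBilin' y z := by
    have : 2 ^ 8 * M.toBilin' y z = 4 * binaryBilin F.diag (F.coord y) (F.coord z)
        + F.diag 2 * (4 * F.coord y 2 * F.coord z 2) := by
      rw [binaryBilin]
      linear_combination 4 * F.mul_toBilin' y z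
    exact this ▸ dvd_add h (dvd_mul_right _ _)
  refine (mul_dvd_mul_iff_left (OfNat.ofNat_ne_zero 64 : (64 : R) ≠ 0)).1 ?_
  convert mul_dvd_mul hg hyz using 1
  · exact F.mul_eq.symm
  · ring

end Domain

lemma coord_mem_diagZeros {y : Fin 3 → R} (h : M.toBilin' y y = 0) :
    F.coord y ∈ diagZeros F.diag := by
  rw [mem_diagZeros]
  linear_combination 64 * h - F.mul_toBilin' y y

lemma dvd_det_mul_of_dvd_coord {r : R} {y : Fin 3 → R} (h : ∀ i, r ∣ F.coord y i) (j : Fin 3) :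
    r ∣ F.vectors.det * y j := by
  rw [← smul_eq_mul, ← Pi.smul_apply, ← coords_vecMul, vecMul, dotProduct]
  exact Finset.dvd_sum fun i _ => (h i).mul_right _

end OrthogonalFrame

end OrthogonalFrame

section PadicMatrix

lemma intCast_toBilin' {n R : Type*} [Fintype n] [DecidableEq n] [CommRing R]
    (M : Matrix n n ℤ) (y z : n → ℤ) :
    (M.map (Int.castRingHom R)).toBilin' (Int.cast ∘ y) (Int.cast ∘ z) =
      ((M.toBilin' y z : ℤ) : R) := by
  simp [toBilin'_apply]

variable {p : ℕ} [Fact p.Prime]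

lemma padicInt_dvd_intCast_iff {z : ℤ} : (p : ℤ_[p]) ∣ z ↔ (p : ℤ) ∣ z := by
  simpa using PadicInt.pow_p_dvd_int_iff (p := p) 1 z

lemma padicInt_valuation_intCast {z : ℤ} (hz : z ≠ 0) :
    (z : ℤ_[p]).valuation = z.natAbs.factorization p := by
  refine eq_of_forall_le_iff fun k => ?_
  rw [← padicInt_pow_dvd_iff (by exact_mod_cast hz), PadicInt.pow_p_dvd_int_iff,
    ← (Fact.out : p.Prime).pow_dvd_iff_le_factorization (Int.natAbs_ne_zero.2 hz),
    ← Int.natCast_dvd, Nat.cast_pow]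

lemma padicInt_valuation_eq_zero {x : ℤ_[p]} (hx : IsUnit x) : x.valuation = 0 := by
  have h := padicInt_isUnit_iff.1 hx
  rw [← pow_one (p : ℤ_[p]), padicInt_pow_dvd_iff hx.ne_zero] at h
  lia

/-- The associated matrix of `Q`, viewed over `ℤ_p`. -/
noncomputable abbrev padicMatrix (Q : MvPolynomial (Fin 3) ℤ) (p : ℕ) [Fact p.Prime] :
    Matrix (Fin 3) (Fin 3) ℤ_[p] :=
  (assocMatrix Q).map (Int.castRingHom ℤ_[p])

variable {Q : MvPolynomial (Fin 3) ℤ}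

lemma padicMatrix_det : (padicMatrix Q p).det = (discr Q : ℤ_[p]) :=
  ((Int.castRingHom ℤ_[p]).map_det (assocMatrix Q)).symm

lemma padicMatrix_adjugate (i j : Fin 3) :
    (padicMatrix Q p).adjugate i j = ((assocMatrix Q).adjugate i j : ℤ_[p]) :=
  (congrFun₂ ((Int.castRingHom ℤ_[p]).map_adjugate (assocMatrix Q)) i j).symm

variable (F : OrthogonalFrame (padicMatrix Q p))

include F

lemma padic_diag_ne_zero (hΔ : discr Q ≠ 0) (i : Fin 3) : F.diag i ≠ 0 :=
  F.diag_ne_zero (by rw [padicMatrix_det]; exact_mod_cast hΔ) i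

lemma sum_valuation_diag (hΔ : discr Q ≠ 0) :
    (F.diag 0).valuation + (F.diag 1).valuation + (F.diag 2).valuation =
      (discr Q).natAbs.factorization p + if p = 2 then 6 else 0 := by
  have hd := padic_diag_ne_zero F hΔ
  have hmul : F.diag 0 * F.diag 1 * F.diag 2 = ((64 * discr Q : ℤ) : ℤ_[p]) := by
    rw [F.mul_eq, padicMatrix_det]
    push_cast
    rfl
  have h64 : Nat.factorization 64 p = if p = 2 then 6 else 0 := by
    rw [show 64 = 2 ^ 6 by norm_num, Nat.prime_two.factorization_pow, Finsupp.single_apply]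
    simp only [eq_comm]
  rw [← PadicInt.valuation_mul (hd 0) (hd 1),
    ← PadicInt.valuation_mul (mul_ne_zero (hd 0) (hd 1)) (hd 2), hmul,
    padicInt_valuation_intCast (mul_ne_zero (by norm_num) hΔ), Int.natAbs_mul,
    Nat.factorization_mul (by norm_num) (Int.natAbs_ne_zero.2 hΔ), Finsupp.add_apply, add_comm]
  congr 1

lemma diag_mul_diag_dvd_minorGcd (hΔ : discr Q ≠ 0) :
    F.diag 0 * F.diag 1 ∣ 64 * (minorGcd Q : ℤ_[p]) := by
  have hassoc := padicInt_associated_pow_valuation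
    (mul_ne_zero (padic_diag_ne_zero F hΔ 0) (padic_diag_ne_zero F hΔ 1))
  have hdvd : p ^ (F.diag 0 * F.diag 1).valuation ∣ 64 * minorGcd Q := by
    refine dvd_mul_minorGcd_iff.2 fun i j => ?_
    have h := hassoc.dvd.trans (F.dvd_adjugate i j)
    rw [padicMatrix_adjugate] at h
    exact_mod_cast (PadicInt.pow_p_dvd_int_iff _ (64 * (assocMatrix Q).adjugate i j)).1
      (by exact_mod_cast h)
  rw [← hassoc.dvd_iff_dvd_left]
  exact_mod_cast Nat.cast_dvd_cast (α := ℤ_[p]) hdvd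

lemma dvd_diag_mul_diag (hp : p ∣ minorGcd Q) : (p : ℤ_[p]) ∣ F.diag 0 * F.diag 1 := by
  refine F.dvd_mul_of_dvd_adjugate fun i j => ?_
  rw [padicMatrix_adjugate, padicInt_dvd_intCast_iff]
  simpa using dvd_mul_minorGcd_iff (m := 1).1 (by simpa using hp) i j

lemma isUnit_diag (hΔ : discr Q ≠ 0) (hp : ¬ p ∣ 2 * minorGcd Q) :
    IsUnit (F.diag 0) ∧ IsUnit (F.diag 1) := by
  rw [← IsUnit.mul_iff, padicInt_isUnit_iff]
  intro h
  have h64 : (p : ℤ) ∣ ((2 ^ 6 * minorGcd Q : ℕ) : ℤ) := padicInt_dvd_intCast_iff.1 <| by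
    simpa using (show (64 : ℤ_[p]) = 2 ^ 6 by norm_num) ▸
      h.trans (diag_mul_diag_dvd_minorGcd F hΔ)
  rw [Int.natCast_dvd_natCast, (Fact.out : p.Prime).dvd_mul] at h64
  exact hp ((h64.imp_left (Fact.out : p.Prime).dvd_of_dvd_pow).elim (·.mul_right _) (·.mul_left _))

lemma isUnit_det_vectors (hp : p ≠ 2) : IsUnit F.vectors.det := by
  rw [← isUnit_pow_iff two_ne_zero, F.det_sq, padicInt_isUnit_iff]
  intro h
  have h64 : (p : ℤ) ∣ ((2 ^ 6 : ℕ) : ℤ) := padicInt_dvd_intCast_iff.1 <| by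
    simpa using (show (64 : ℤ_[p]) = 2 ^ 6 by norm_num) ▸ h
  exact hp ((Nat.prime_dvd_prime_iff_eq Fact.out Nat.prime_two).1
    ((Fact.out : p.Prime).dvd_of_dvd_pow (Int.natCast_dvd_natCast.1 h64)))

end PadicMatrix

section LocalClasses

open MvPolynomial

/-- The primitive integer zeros of `Q`. -/
def primitiveZeroSet (Q : MvPolynomial (Fin 3) ℤ) : Set (Fin 3 → ℤ) :=
  {y | Finset.univ.gcd y = 1 ∧ eval y Q = 0}

/-- The primitive integer zeros of `Q` can be divided into `n` classes such that zeros in the same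
class are orthogonal modulo `a`, up to the factor `2 ^ 8 * D_Q`. -/
def HasOrthogonalClasses (Q : MvPolynomial (Fin 3) ℤ) (a n : ℕ) : Prop :=
  ∃ c : primitiveZeroSet Q → Fin n, ∀ s t, c s = c t →
    (a : ℤ) ∣ 2 ^ 8 * minorGcd Q * (assocMatrix Q).toBilin' s.1 t.1

variable {Q : MvPolynomial (Fin 3) ℤ} {p : ℕ} [Fact p.Prime]

lemma hasOrthogonalClasses_of_lt {a n : ℕ} (c : primitiveZeroSet Q → ℕ)
    (hc : ∀ s t, c s = c t → (a : ℤ) ∣ 2 ^ 8 * minorGcd Q * (assocMatrix Q).toBilin' s.1 t.1)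
    (hn : ∀ s, c s < n) : HasOrthogonalClasses Q a n :=
  ⟨fun s => ⟨c s, hn s⟩, fun s t h => hc s t (congrArg Fin.val h)⟩

lemma ne_two_of_not_dvd_two_mul {k m : ℕ} (h : ¬ k ∣ 2 * m) : k ≠ 2 :=
  fun hk => h (hk ▸ dvd_mul_right _ _)

lemma exists_not_dvd_of_mem_primitiveZeroSet {y : Fin 3 → ℤ} (hy : y ∈ primitiveZeroSet Q) :
    ∃ i, ¬ (p : ℤ_[p]) ∣ y i := by
  by_contra! h
  have hgcd : (p : ℤ) ∣ Finset.univ.gcd y :=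
    Finset.dvd_gcd fun i _ => padicInt_dvd_intCast_iff.1 (h i)
  rw [hy.1] at hgcd
  exact (Nat.prime_iff_prime_int.1 Fact.out).not_dvd_one hgcd

lemma coord_mem_diagZeros_of_mem (hQ : Q.IsHomogeneous 2) (F : OrthogonalFrame (padicMatrix Q p))
    {y : Fin 3 → ℤ} (hy : y ∈ primitiveZeroSet Q) :
    F.coord (Int.cast ∘ y) ∈ diagZeros F.diag := by
  refine F.coord_mem_diagZeros ?_
  rw [intCast_toBilin', toBilin'_eq_zero_of_eval hQ hy.2, Int.cast_zero]

lemma exists_frame_classes (hQ : Q.IsHomogeneous 2) (hΔ : discr Q ≠ 0)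
    (F : OrthogonalFrame (padicMatrix Q p)) : ∃ c : primitiveZeroSet Q → ℕ,
    (∀ s t, c s = c t → ((p ^ (discr Q).natAbs.factorization p : ℕ) : ℤ) ∣
      2 ^ 8 * minorGcd Q * (assocMatrix Q).toBilin' s.1 t.1) ∧
    ∀ s, c s ≤ 2 * (((F.diag 2).valuation - (F.diag 1).valuation + 1) / 2) ∧
      (c s = 2 * (((F.diag 2).valuation - (F.diag 1).valuation + 1) / 2) ↔
        F.diag 2 ∣ F.diag 0 * F.coord (Int.cast ∘ s.1) 0 ^ 2) := by
  obtain ⟨c, hc, hc'⟩ := exists_zero_classes (padic_diag_ne_zero F hΔ)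
  refine ⟨fun s => c (F.coord (Int.cast ∘ s.1)), fun s t hst => ?_,
    fun s => hc' _ (coord_mem_diagZeros_of_mem hQ F s.2)⟩
  have hdet := F.det_dvd_of_dvd_binaryBilin (diag_mul_diag_dvd_minorGcd F hΔ)
    (hc _ (coord_mem_diagZeros_of_mem hQ F s.2) _ (coord_mem_diagZeros_of_mem hQ F t.2) hst)
  rw [intCast_toBilin', padicMatrix_det,
    ← (padicInt_associated_pow_valuation (by exact_mod_cast hΔ)).dvd_iff_dvd_left,
    padicInt_valuation_intCast hΔ] at hdet
  rw [Nat.cast_pow, ← PadicInt.pow_p_dvd_int_iff]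
  exact_mod_cast hdet

lemma hasOrthogonalClasses_of_dvd (hQ : Q.IsHomogeneous 2) (hΔ : discr Q ≠ 0)
    (hp : p ∣ 2 * minorGcd Q) :
    HasOrthogonalClasses Q (p ^ (discr Q).natAbs.factorization p)
      ((if p = 2 then 8 else 1) * ((discr Q).natAbs.factorization p + 1)) := by
  obtain ⟨F⟩ := nonempty_orthogonalFrame ((assocMatrix_isSymm Q).map (Int.castRingHom ℤ_[p]))
  obtain ⟨c, hc, hle⟩ := exists_frame_classes hQ hΔ F
  refine hasOrthogonalClasses_of_lt c hc fun s => (hle s).1.trans_lt ?_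
  have hsum := sum_valuation_diag F hΔ
  split_ifs at hsum ⊢ with h
  · lia
  · have hpD : p ∣ minorGcd Q := ((Fact.out : p.Prime).dvd_mul.1 hp).resolve_left fun h' =>
      h ((Nat.prime_dvd_prime_iff_eq Fact.out Nat.prime_two).1 h')
    have hd := padic_diag_ne_zero F hΔ
    have hval : 1 ≤ (F.diag 0 * F.diag 1).valuation := by
      rw [← padicInt_pow_dvd_iff (mul_ne_zero (hd 0) (hd 1)), pow_one]
      exact dvd_diag_mul_diag F hpD
    rw [PadicInt.valuation_mul (hd 0) (hd 1)] at hval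
    lia

section GoodPrime

variable (hΔ : discr Q ≠ 0) (hp : ¬ p ∣ 2 * minorGcd Q) (F : OrthogonalFrame (padicMatrix Q p))

include hΔ hp

lemma valuation_diag_two :
    (F.diag 2).valuation = (discr Q).natAbs.factorization p := by
  have hunit := isUnit_diag F hΔ hp
  have hsum := sum_valuation_diag F hΔ
  rwa [padicInt_valuation_eq_zero hunit.1, padicInt_valuation_eq_zero hunit.2, zero_add, zero_add,
    if_neg (ne_two_of_not_dvd_two_mul hp), add_zero] at hsum

lemma zerosMod_eq_of_frame (hQ : Q.IsHomogeneous 2) (hpΔ : (p : ℤ) ∣ discr Q) :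
    (zerosMod Q p : ℤ) = p * (p - 1) * (1 + quadraticChar (ZMod p)
      (-(PadicInt.toZMod (F.diag 0) * PadicInt.toZMod (F.diag 1)))) + p - 1 := by
  have hunit := isUnit_diag F hΔ hp
  have hp2 := ne_two_of_not_dvd_two_mul hp
  have hmap : (assocMatrix Q).map (Int.castRingHom (ZMod p)) =
      (PadicInt.toZMod (p := p)).mapMatrix (padicMatrix Q p) := by
    ext i j
    simp
  refine zerosMod_eq hQ hp2 (P := PadicInt.toZMod.mapMatrix F.vectors)
    (d := PadicInt.toZMod ∘ F.diag) ?_ ?_ (padicInt_toZMod_ne_zero_iff.2 hunit.1) ?_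
  · rw [isUnit_iff_isUnit_det, ← RingHom.map_det]
    exact (isUnit_det_vectors F hp2).map _
  · have hform := (congrArg PadicInt.toZMod.mapMatrix F.form_eq).trans
      (diagonal_map (map_zero (PadicInt.toZMod (p := p))))
    rw [map_mul, map_mul] at hform
    exact hmap ▸ hform
  · refine of_not_not (mt padicInt_toZMod_ne_zero_iff.1 fun hunit₂ => ?_)
    have hξ := valuation_diag_two hΔ hp F
    rw [padicInt_valuation_eq_zero hunit₂] at hξ
    exact (Nat.Prime.factorization_pos_of_dvd Fact.out (Int.natAbs_ne_zero.2 hΔ)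
      (Int.natCast_dvd.1 hpΔ)).ne hξ

lemma not_dvd_of_odd (hQ : Q.IsHomogeneous 2) (hodd : Odd ((discr Q).natAbs.factorization p))
    {y : Fin 3 → ℤ} (hy : y ∈ primitiveZeroSet Q) :
    ¬ F.diag 2 ∣ F.diag 0 * F.coord (Int.cast ∘ y) 0 ^ 2 := by
  intro h
  have hunit := isUnit_diag F hΔ hp
  rw [← valuation_diag_two hΔ hp F] at hodd
  obtain ⟨i, hi⟩ := exists_not_dvd_of_mem_primitiveZeroSet (p := p) hy
  have hdvd := F.dvd_det_mul_of_dvd_coord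
    (dvd_of_odd_valuation hunit.1 hunit.2 hodd (coord_mem_diagZeros_of_mem hQ F hy) h) i
  exact hi ((isUnit_det_vectors F (ne_two_of_not_dvd_two_mul hp)).dvd_mul_left.1 hdvd)

lemma exists_sign_hasOrthogonalClasses (hQ : Q.IsHomogeneous 2) (hpΔ : (p : ℤ) ∣ discr Q) :
    ∃ ε : ℤ, (ε = 1 ∨ ε = -1) ∧ (zerosMod Q p : ℤ) = p * (p - 1) * (1 + ε) + p - 1 ∧
      ∃ n : ℕ, (n : ℤ) = ∑ k ∈ Finset.range ((discr Q).natAbs.factorization p + 1), ε ^ k ∧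
        HasOrthogonalClasses Q (p ^ (discr Q).natAbs.factorization p) n := by
  obtain ⟨F⟩ := nonempty_orthogonalFrame ((assocMatrix_isSymm Q).map (Int.castRingHom ℤ_[p]))
  obtain ⟨c, hc, hle⟩ := exists_frame_classes hQ hΔ F
  have hunit := isUnit_diag F hΔ hp
  have hodd (s : primitiveZeroSet Q) := (not_dvd_of_odd hΔ hp F hQ · s.2)
  rw [padicInt_valuation_eq_zero hunit.2, valuation_diag_two hΔ hp F] at hle
  have hne : -(PadicInt.toZMod (F.diag 0) * PadicInt.toZMod (F.diag 1)) ≠ 0 :=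
    neg_ne_zero.2 (mul_ne_zero (padicInt_toZMod_ne_zero_iff.2 hunit.1)
      (padicInt_toZMod_ne_zero_iff.2 hunit.2))
  refine ⟨_, quadraticChar_dichotomy hne, zerosMod_eq_of_frame hΔ hp F hQ hpΔ, ?_⟩
  rcases quadraticChar_dichotomy hne with hε | hε
  · refine ⟨(discr Q).natAbs.factorization p + 1, by simp [hε],
      hasOrthogonalClasses_of_lt c hc fun s => ?_⟩
    simp only [Nat.sub_zero] at hle
    have := hodd s
    have := hle s
    grind
  · have hall (s : primitiveZeroSet Q) :
        F.diag 2 ∣ F.diag 0 * F.coord (Int.cast ∘ s.1) 0 ^ 2 := by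
      by_contra h
      have hsq := isSquare_toZMod_of_not_dvd hunit.1 hunit.2
        (coord_mem_diagZeros_of_mem hQ F s.2) h
      rw [← quadraticChar_one_iff_isSquare hne, hε] at hsq
      norm_num at hsq
    refine ⟨if Even ((discr Q).natAbs.factorization p + 1) then 0 else 1,
      by rw [hε, neg_one_geom_sum, Nat.cast_ite, Nat.cast_zero, Nat.cast_one],
      hasOrthogonalClasses_of_lt (fun _ => 0) (fun s t _ => hc s t ?_) fun s => ?_⟩
    · rw [(hle s).2.2 (hall s), (hle t).2.2 (hall t)]
    · have := mt (hodd s) (not_not.2 (hall s))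
      grind

end GoodPrime

end LocalClasses

section QuadraticCharacter

open NumberTheorySymbols

/-- The Jacobi symbol `J(· | b)` as a Dirichlet character modulo `b`. -/
def jacobiChar (b : ℕ) [NeZero b] : DirichletCharacter ℤ b where
  toFun x := J(x.val | b)
  map_one' := by rw [ZMod.val_one_eq_one_mod, Int.natCast_mod, ← jacobiSym.mod_left]; simp
  map_mul' x y := by
    rw [ZMod.val_mul, Int.natCast_mod, ← jacobiSym.mod_left, Nat.cast_mul, jacobiSym.mul_left]
  map_nonunit' x hx := by
    rw [← ZMod.natCast_zmod_val x, ZMod.isUnit_iff_coprime] at hx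
    exact jacobiSym.eq_zero_iff.2 ⟨NeZero.ne b, hx⟩

lemma jacobiChar_natCast (b : ℕ) [NeZero b] (n : ℕ) : jacobiChar b n = J(n | b) := by
  change J((n : ZMod b).val | b) = _
  rw [ZMod.val_natCast, Int.natCast_mod, ← jacobiSym.mod_left]

lemma jacobiChar_isQuadratic (b : ℕ) [NeZero b] : (jacobiChar b).IsQuadratic :=
  fun x => jacobiSym.trichotomy x.val b

lemma exists_jacobiSym_eq {p : ℕ} (hp : p.Prime) (hp2 : p ≠ 2) {ε : ℤ} (hε : ε = 1 ∨ ε = -1) :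
    ∃ a : ℕ, J(a | p) = ε := by
  have : Fact p.Prime := ⟨hp⟩
  rcases hε with rfl | rfl
  · exact ⟨1, by simp⟩
  · obtain ⟨a, ha⟩ := quadraticChar_exists_neg_one (F := ZMod p) (by rwa [ZMod.ringChar_zmod_n])
    exact ⟨a.val, by simpa [← jacobiSym.legendreSym.to_jacobiSym, legendreSym] using ha⟩

variable {P : Finset ℕ} {ε : ℕ → ℤ}

lemma exists_mod_four_eq_one_jacobiSym_eq (hP : ∀ p ∈ P, p.Prime) (hP2 : 2 ∉ P)
    (hε : ∀ p ∈ P, ε p = 1 ∨ ε p = -1) : ∃ b : ℕ, b % 4 = 1 ∧ ∀ p ∈ P, J(b | p) = ε p := by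
  choose! a ha using fun p (hp : p ∈ P) =>
    exists_jacobiSym_eq (hP p hp) (ne_of_mem_of_not_mem hp hP2) (hε p hp)
  obtain ⟨k, hk⟩ := Nat.chineseRemainderOfFinset a id P (fun p hp => (hP p hp).ne_zero)
    fun p hp q hq hpq => (Nat.coprime_primes (hP p hp) (hP q hq)).2 hpq
  have hcop : Nat.Coprime 4 (∏ p ∈ P, p) := Nat.Coprime.prod_right fun p hp =>
    Nat.Coprime.pow_left 2 ((Nat.coprime_primes Nat.prime_two (hP p hp)).2
      (ne_of_mem_of_not_mem hp hP2).symm)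
  obtain ⟨b, hb4, hbk⟩ := Nat.chineseRemainder hcop 1 k
  refine ⟨b, hb4, fun p hp => ?_⟩
  rw [← ha p hp, jacobiSym.mod_left' (Int.natCast_modEq_iff.2
    ((hbk.of_dvd (Finset.dvd_prod_of_mem _ hp)).trans (hk p hp)))]

lemma exists_isQuadratic_apply_eq (hP : ∀ p ∈ P, p.Prime) (hP2 : 2 ∉ P)
    (hε : ∀ p ∈ P, ε p = 1 ∨ ε p = -1) :
    ∃ (N : ℕ) (_ : NeZero N) (χ : DirichletCharacter ℤ N),
      χ.IsQuadratic ∧ ∀ p ∈ P, χ (p : ZMod N) = ε p := by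
  obtain ⟨b, hb4, hb⟩ := exists_mod_four_eq_one_jacobiSym_eq hP hP2 hε
  have : NeZero b := ⟨by rintro rfl; simp at hb4⟩
  refine ⟨b, this, jacobiChar b, jacobiChar_isQuadratic b, fun p hp => ?_⟩
  have hodd : Odd p := (hP p hp).odd_of_ne_two (ne_of_mem_of_not_mem hp hP2)
  rw [jacobiChar_natCast, ← hb p hp, jacobiSym.quadratic_reciprocity_one_mod_four hb4 hodd]

lemma exists_isAssocCharacter {Q : MvPolynomial (Fin 3) ℤ} (hQ : Q.IsHomogeneous 2)
    (hΔ : discr Q ≠ 0) :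
    ∃ (N : ℕ) (_ : NeZero N) (χ : DirichletCharacter ℤ N), IsAssocCharacter Q χ := by
  set P := (discr Q).natAbs.primeFactors.filter fun p => ¬ p ∣ 2 * minorGcd Q
  have hmem (p : ℕ) : p ∈ P ↔ p.Prime ∧ (p : ℤ) ∣ discr Q ∧ ¬ p ∣ 2 * minorGcd Q := by
    simp [P, Int.natCast_dvd, hΔ, and_assoc]
  have hsign (p : ℕ) (hp : p ∈ P) : ∃ ε : ℤ, (ε = 1 ∨ ε = -1) ∧
      (zerosMod Q p : ℤ) = p * (p - 1) * (1 + ε) + p - 1 := by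
    obtain ⟨hp, hpΔ, hpD⟩ := (hmem p).1 hp
    have : Fact p.Prime := ⟨hp⟩
    obtain ⟨ε, hε, hcard, -⟩ := exists_sign_hasOrthogonalClasses hΔ hpD hQ hpΔ
    exact ⟨ε, hε, hcard⟩
  choose! ε hε hcard using hsign
  obtain ⟨N, hN, χ, hχ, heq⟩ := exists_isQuadratic_apply_eq (P := P) (ε := ε)
    (fun p hp => ((hmem p).1 hp).1)
    (fun h2 => ((hmem 2).1 h2).2.2 (dvd_mul_right _ _)) hε
  refine ⟨N, hN, χ, hχ, fun p hp hpΔ hpD => ?_⟩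
  have hpP := (hmem p).2 ⟨hp, hpΔ, hpD⟩
  rw [heq p hpP, hcard p hpP]

end QuadraticCharacter

section GlobalClasses

open MvPolynomial

variable {Q : MvPolynomial (Fin 3) ℤ} {N : ℕ} {χ : DirichletCharacter ℤ N}

open Classical in
/-- The factor of `constC Q χ w` at a prime `p` dividing the discriminant. -/
noncomputable def localFactor (Q : MvPolynomial (Fin 3) ℤ) (χ : DirichletCharacter ℤ N)
    (w : ℝ) (p : ℕ) : ℤ :=
  if p ∣ 2 * minorGcd Q ∨ (p : ℝ) ≤ w then (discr Q).natAbs.factorization p + 1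
  else ∑ k ∈ Finset.range ((discr Q).natAbs.factorization p + 1), χ (p : ZMod N) ^ k

lemma constC_eq_prod (Q : MvPolynomial (Fin 3) ℤ) (χ : DirichletCharacter ℤ N) (w : ℝ) :
    constC Q χ w = ∏ p ∈ (discr Q).natAbs.primeFactors, localFactor Q χ w p := by
  simp only [constC, localFactor, Finset.prod_ite, not_or, not_le]
  congr 1
  refine Finset.prod_congr rfl fun p hp => ?_
  rw [Nat.divisors_prime_pow (Nat.prime_of_mem_primeFactors (Finset.mem_filter.1 hp).1),
    Finset.card_map, Finset.card_range, Nat.cast_succ]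

lemma hasOrthogonalClasses_one : HasOrthogonalClasses Q 1 1 :=
  ⟨fun _ => 0, fun _ _ _ => by simp only [Nat.cast_one, one_dvd]⟩

lemma HasOrthogonalClasses.mul {a b m n : ℕ} (ha : HasOrthogonalClasses Q a m)
    (hb : HasOrthogonalClasses Q b n) (hab : a.Coprime b) :
    HasOrthogonalClasses Q (a * b) (m * n) := by
  obtain ⟨c, hc⟩ := ha
  obtain ⟨d, hd⟩ := hb
  refine ⟨fun s => finProdFinEquiv (c s, d s), fun s t hst => ?_⟩
  obtain ⟨hcst, hdst⟩ := Prod.ext_iff.1 (finProdFinEquiv.injective hst)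
  rw [Nat.cast_mul]
  exact hab.isCoprime.mul_dvd (hc s t hcst) (hd s t hdst)

lemma HasOrthogonalClasses.prod {ι : Type*} {S : Finset ι} {a n : ι → ℕ}
    (h : ∀ i ∈ S, HasOrthogonalClasses Q (a i) (n i))
    (hcop : (S : Set ι).Pairwise fun i j => (a i).Coprime (a j)) :
    HasOrthogonalClasses Q (∏ i ∈ S, a i) (∏ i ∈ S, n i) := by
  classical
  induction S using Finset.induction_on with
  | empty => exact hasOrthogonalClasses_one
  | insert i S hi ih =>
    rw [Finset.prod_insert hi, Finset.prod_insert hi]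
    refine (h i (Finset.mem_insert_self i S)).mul
      (ih (fun j hj => h j (Finset.mem_insert_of_mem hj))
        (hcop.mono (Finset.coe_subset.2 (Finset.subset_insert i S))))
      (Nat.Coprime.prod_right fun j hj => hcop (Finset.mem_insert_self i S)
        (Finset.mem_insert_of_mem hj) (ne_of_mem_of_not_mem hj hi).symm)

lemma geom_sum_sign_le {ε : ℤ} (hε : ε = 1 ∨ ε = -1) (n : ℕ) :
    ∑ k ∈ Finset.range n, ε ^ k ≤ n := by
  have hle (k : ℕ) : ε ^ k ≤ 1 := by
    refine (le_abs_self _).trans_eq ?_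
    rw [abs_pow, abs_eq zero_le_one |>.2 hε, one_pow]
  simpa only [Finset.card_range, nsmul_one] using
    Finset.sum_le_card_nsmul (Finset.range n) (ε ^ ·) 1 fun k _ => hle k

lemma IsAssocCharacter.apply_eq (hχ : IsAssocCharacter Q χ) {p : ℕ} (hp : p.Prime)
    (hpΔ : (p : ℤ) ∣ discr Q) (hpD : ¬ p ∣ 2 * minorGcd Q) {ε : ℤ}
    (hε : (zerosMod Q p : ℤ) = p * (p - 1) * (1 + ε) + p - 1) : χ (p : ZMod N) = ε := by
  have hp1 : (1 : ℤ) < p := by exact_mod_cast hp.one_lt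
  have hcount := hε.symm.trans (hχ.2 p hp hpΔ hpD)
  refine mul_left_cancel₀ (mul_ne_zero (by lia) (by lia) : (p : ℤ) * (p - 1) ≠ 0) ?_
  linear_combination -hcount

lemma exists_local_hasOrthogonalClasses (hQ : Q.IsHomogeneous 2) (hΔ : discr Q ≠ 0)
    (hχ : IsAssocCharacter Q χ) (w : ℝ) {p : ℕ} (hp : p.Prime) (hpΔ : (p : ℤ) ∣ discr Q) :
    ∃ n : ℕ, (n : ℤ) ≤ (if p = 2 then 8 else 1) * localFactor Q χ w p ∧
      HasOrthogonalClasses Q (p ^ (discr Q).natAbs.factorization p) n := by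
  have : Fact p.Prime := ⟨hp⟩
  by_cases hpD : p ∣ 2 * minorGcd Q
  · refine ⟨_, ?_, hasOrthogonalClasses_of_dvd hQ hΔ hpD⟩
    rw [localFactor, if_pos (Or.inl hpD)]
    push_cast
    rfl
  · obtain ⟨ε, hε, hzeros, n, hn, hclasses⟩ := exists_sign_hasOrthogonalClasses hΔ hpD hQ hpΔ
    refine ⟨n, ?_, hclasses⟩
    rw [if_neg (ne_two_of_not_dvd_two_mul hpD), one_mul, localFactor,
      hχ.apply_eq hp hpΔ hpD hzeros, hn]
    split_ifs
    · exact_mod_cast geom_sum_sign_le hε _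
    · rfl

lemma exists_hasOrthogonalClasses (hQ : Q.IsHomogeneous 2) (hΔ : discr Q ≠ 0)
    (hχ : IsAssocCharacter Q χ) (w : ℝ) :
    ∃ n : ℕ, (n : ℤ) ≤ 8 * constC Q χ w ∧ HasOrthogonalClasses Q (discr Q).natAbs n := by
  have hprime {p : ℕ} (hp : p ∈ (discr Q).natAbs.primeFactors) := Nat.prime_of_mem_primeFactors hp
  have hloc : ∀ p ∈ (discr Q).natAbs.primeFactors, ∃ n : ℕ,
      (n : ℤ) ≤ (if p = 2 then 8 else 1) * localFactor Q χ w p ∧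
        HasOrthogonalClasses Q (p ^ (discr Q).natAbs.factorization p) n := fun p hp =>
    exists_local_hasOrthogonalClasses hQ hΔ hχ w (hprime hp)
      (Int.natCast_dvd.2 (Nat.dvd_of_mem_primeFactors hp))
  choose! n hle hclasses using hloc
  have hglobal := HasOrthogonalClasses.prod hclasses fun p hp q hq hpq =>
    Nat.coprime_pow_primes _ _ (hprime hp) (hprime hq) hpq
  have hfactor : ∏ p ∈ (discr Q).natAbs.primeFactors, p ^ (discr Q).natAbs.factorization p =
      (discr Q).natAbs := Nat.prod_factorization_pow_eq_self (Int.natAbs_ne_zero.2 hΔ)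
  refine ⟨_, ?_, hfactor ▸ hglobal⟩
  have hprod := Finset.prod_le_prod (fun p _ => Int.natCast_nonneg (n p)) hle
  rw [Finset.prod_mul_distrib, ← constC_eq_prod, Finset.prod_ite_eq'] at hprod
  have hnonneg := Finset.prod_nonneg fun p (_ : p ∈ (discr Q).natAbs.primeFactors) =>
    Int.natCast_nonneg (n p)
  rw [Nat.cast_prod]
  split_ifs at hprod <;> lia

lemma constC_nonneg (hQ : Q.IsHomogeneous 2) (hΔ : discr Q ≠ 0) (hχ : IsAssocCharacter Q χ)
    (w : ℝ) : 0 ≤ constC Q χ w := by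
  obtain ⟨n, hn, -⟩ := exists_hasOrthogonalClasses hQ hΔ hχ w
  lia

end GlobalClasses

section Counting

open MvPolynomial

variable {Q : MvPolynomial (Fin 3) ℤ} {N : ℕ} {χ : DirichletCharacter ℤ N}

lemma det3_sq_mul_det {R : Type*} [CommRing R] {M : Matrix (Fin 3) (Fin 3) R} (hM : M.IsSymm)
    {s t u : Fin 3 → R} (hs : M.toBilin' s s = 0) (ht : M.toBilin' t t = 0)
    (hu : M.toBilin' u u = 0) :
    det3 s t u ^ 2 * M.det = 2 * (M.toBilin' s t * M.toBilin' t u * M.toBilin' s u) := by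
  have hcomm : ∀ x y, M.toBilin' x y = M.toBilin' y x :=
    (isSymm_toBilin'_iff_isSymm.2 hM).eq
  have hform : of ![s, t, u] * M * (of ![s, t, u])ᵀ =
      !![0, M.toBilin' s t, M.toBilin' s u; M.toBilin' s t, 0, M.toBilin' t u;
        M.toBilin' s u, M.toBilin' t u, 0] := by
    ext i j
    rw [mul_mul_transpose_apply]
    change M.toBilin' (![s, t, u] i) (![s, t, u] j) = _
    fin_cases i <;> fin_cases j <;> simp [hs, ht, hu, hcomm t s, hcomm u s, hcomm u t]
  rw [det3, ← det_mul_mul_transpose, hform, det_fin_three]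
  simp only [of_apply, cons_val]
  ring

lemma abs_le_mul_abs_of_dvd {a k x : ℤ} (hk : 0 < k) (hx : x ≠ 0) (h : a ∣ k * x) :
    |a| ≤ k * |x| := by
  rw [← abs_of_pos hk, ← abs_mul]
  exact Int.le_of_dvd (abs_pos.2 (mul_ne_zero hk.ne' hx)) ((abs_dvd_abs _ _).2 h)

lemma sq_mul_two_le_of_dvd {Δ k a b c d : ℤ} (hΔ : Δ ≠ 0) (hk : 0 < k) (hd : d ≠ 0)
    (hgram : d ^ 2 * Δ = 2 * (a * b * c)) (ha : Δ ∣ k * a) (hb : Δ ∣ k * b) (hc : Δ ∣ k * c) :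
    2 * Δ ^ 2 ≤ k ^ 3 * d ^ 2 := by
  have habc : a * b * c ≠ 0 := by
    rintro h
    rw [h, mul_zero] at hgram
    exact mul_ne_zero (pow_ne_zero 2 hd) hΔ hgram
  obtain ⟨⟨ha₀, hb₀⟩, hc₀⟩ := (by simpa only [mul_ne_zero_iff] using habc :
    (a ≠ 0 ∧ b ≠ 0) ∧ c ≠ 0)
  refine le_of_mul_le_mul_left ?_ (abs_pos.2 hΔ)
  calc |Δ| * (2 * Δ ^ 2) = 2 * (|Δ| * |Δ| * |Δ|) := by rw [← sq_abs Δ]; ring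
    _ ≤ 2 * (k * |a| * (k * |b|) * (k * |c|)) := by
      gcongr
      exacts [abs_le_mul_abs_of_dvd hk ha₀ ha, abs_le_mul_abs_of_dvd hk hb₀ hb,
        abs_le_mul_abs_of_dvd hk hc₀ hc]
    _ = k ^ 3 * |2 * (a * b * c)| := by
      simp only [abs_mul, abs_two]
      ring
    _ = |Δ| * (k ^ 3 * d ^ 2) := by
      rw [← hgram, abs_mul, abs_pow, sq_abs]
      ring

lemma discr_sq_le (hQ : Q.IsHomogeneous 2) (hΔ : discr Q ≠ 0) {X : Finset (primitiveZeroSet Q)}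
    (hX : ∀ s ∈ X, ∀ t ∈ X, ((discr Q).natAbs : ℤ) ∣
      2 ^ 8 * minorGcd Q * (assocMatrix Q).toBilin' s.1 t.1)
    {s t u : primitiveZeroSet Q} (hs : s ∈ X) (ht : t ∈ X) (hu : u ∈ X)
    (hd : det3 s.1 t.1 u.1 ≠ 0) :
    discr Q ^ 2 ≤ (2 ^ 8 * minorGcd Q) ^ 3 * det3 s.1 t.1 u.1 ^ 2 := by
  have hgram := det3_sq_mul_det (assocMatrix_isSymm Q) (toBilin'_eq_zero_of_eval hQ s.2.2)
    (toBilin'_eq_zero_of_eval hQ t.2.2) (toBilin'_eq_zero_of_eval hQ u.2.2)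
  have hD : 0 < 2 ^ 8 * (minorGcd Q : ℤ) := by
    have := minorGcd_ne_zero hΔ
    positivity
  have hle := sq_mul_two_le_of_dvd hΔ hD hd hgram (Int.natAbs_dvd.1 (hX s hs t ht))
    (Int.natAbs_dvd.1 (hX t ht u hu)) (Int.natAbs_dvd.1 (hX s hs u hu))
  linarith [sq_nonneg (discr Q)]

lemma IsIsotropic.exists_toBilin'_eq_zero {K : Type*} [Field K] [CharZero K]
    (hiso : IsIsotropic Q) (hQ : Q.IsHomogeneous 2) :
    ∃ e : Fin 3 → K, e ≠ 0 ∧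
      ((assocMatrix Q).map (Int.castRingHom K)).toBilin' e e = 0 := by
  obtain ⟨e, he, hQe⟩ := hiso
  refine ⟨algebraMap ℚ K ∘ e, fun h => he ?_, ?_⟩
  · ext i
    exact (map_eq_zero (algebraMap ℚ K)).1 (congrFun h i)
  · rw [← two_mul_aeval hQ, aeval_algebraMap_apply, hQe, map_zero, mul_zero]

lemma card_mul_le_of_orthogonal (hQ : Q.IsHomogeneous 2) (hΔ : discr Q ≠ 0)
    (hiso : IsIsotropic Q) {B : Fin 3 → ℝ} (hB : ∀ i, 0 < B i) {r : ℝ} (hr : 0 < r)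
    (hrB : (r ^ 3 * (B 0 * B 1 * B 2)) ^ 2 * (2 ^ 8 * minorGcd Q) ^ 3 ≤ (discr Q : ℝ) ^ 2)
    {X : Finset (primitiveZeroSet Q)} (hbox : ∀ s ∈ X, ∀ i, |(s.1 i : ℝ)| ≤ B i)
    (hX : ∀ s ∈ X, ∀ t ∈ X, ((discr Q).natAbs : ℤ) ∣
      2 ^ 8 * minorGcd Q * (assocMatrix Q).toBilin' s.1 t.1) :
    (X.card : ℝ) * r ≤ 218 * r + 324 := by
  obtain ⟨e, he, hee⟩ := hiso.exists_toBilin'_eq_zero (K := ℝ) hQ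
  have hdet : ((assocMatrix Q).map (Int.castRingHom ℝ)).det ≠ 0 := by
    rw [← RingHom.mapMatrix_apply, ← RingHom.map_det, eq_intCast]
    exact Int.cast_ne_zero.2 hΔ
  rw [← X.card_map (Function.Embedding.subtype _)]
  refine card_mul_le_of_conic ((assocMatrix_isSymm Q).map _) hdet he hee hB hr ?_ ?_ ?_ ?_ <;>
    simp only [Finset.forall_mem_map, Function.Embedding.subtype_apply]
  · exact fun s _ => s.2.1
  · intro s _
    rw [intCast_toBilin', toBilin'_eq_zero_of_eval hQ s.2.2, Int.cast_zero]
  · exact hbox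
  · intro s hs t ht u hu hd
    have hle : (discr Q : ℝ) ^ 2 ≤
        (2 ^ 8 * minorGcd Q) ^ 3 * ((det3 s.1 t.1 u.1 : ℤ) : ℝ) ^ 2 := by
      exact_mod_cast discr_sq_le hQ hΔ hX hs ht hu hd
    have hD : 0 < (2 ^ 8 * (minorGcd Q : ℝ)) ^ 3 := by
      have := minorGcd_ne_zero hΔ
      positivity
    refine (le_abs_self _).trans (sq_le_sq.1 (le_of_mul_le_mul_right ?_ hD))
    exact hrB.trans (hle.trans_eq (mul_comm _ _))

lemma primitiveZeros_finite (Q : MvPolynomial (Fin 3) ℤ) (B : Fin 3 → ℝ) :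
    (primitiveZeros Q B).Finite := by
  refine (Set.finite_Icc (fun i => -⌊B i⌋) fun i => ⌊B i⌋).subset fun y hy => ?_
  have hle (i : Fin 3) : |y i| ≤ ⌊B i⌋ := Int.le_floor.2 (by exact_mod_cast hy.2.2 i)
  exact ⟨fun i => (abs_le.1 (hle i)).1, fun i => (abs_le.1 (hle i)).2⟩

lemma exists_finset_primitiveZeroSet (Q : MvPolynomial (Fin 3) ℤ) (B : Fin 3 → ℝ) :
    ∃ X : Finset (primitiveZeroSet Q), (primitiveZeros Q B).ncard = X.card ∧
      ∀ s ∈ X, ∀ i, |(s.1 i : ℝ)| ≤ B i := by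
  have hsub : primitiveZeros Q B ⊆ primitiveZeroSet Q := fun y hy => ⟨hy.1, hy.2.1⟩
  have hfin : ((↑) ⁻¹' primitiveZeros Q B : Set (primitiveZeroSet Q)).Finite :=
    (primitiveZeros_finite Q B).preimage Subtype.val_injective.injOn
  refine ⟨hfin.toFinset, ?_, fun s hs => (hfin.mem_toFinset.1 hs).2.2⟩
  rw [← Set.ncard_eq_toFinset_card _ hfin, Set.ncard_preimage_of_injective_subset_range
    Subtype.val_injective (by rwa [Subtype.range_coe])]

lemma ncard_primitiveZeros_mul_le (hQ : Q.IsHomogeneous 2) (hΔ : discr Q ≠ 0)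
    (hiso : IsIsotropic Q) (hχ : IsAssocCharacter Q χ) (w : ℝ) {B : Fin 3 → ℝ}
    (hB : ∀ i, 0 < B i) {r : ℝ} (hr : 0 < r)
    (hrB : (r ^ 3 * (B 0 * B 1 * B 2)) ^ 2 * (2 ^ 8 * minorGcd Q) ^ 3 ≤ (discr Q : ℝ) ^ 2) :
    ((primitiveZeros Q B).ncard : ℝ) * r ≤ 8 * constC Q χ w * (218 * r + 324) := by
  obtain ⟨n, hn, c, hc⟩ := exists_hasOrthogonalClasses hQ hΔ hχ w
  obtain ⟨X, hcard, hbox⟩ := exists_finset_primitiveZeroSet Q B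
  have hclass (k : Fin n) : ({s ∈ X | c s = k}.card : ℝ) * r ≤ 218 * r + 324 := by
    refine card_mul_le_of_orthogonal hQ hΔ hiso hB hr hrB
      (fun s hs => hbox s (Finset.mem_filter.1 hs).1) fun s hs t ht => hc s t ?_
    rw [(Finset.mem_filter.1 hs).2, (Finset.mem_filter.1 ht).2]
  calc ((primitiveZeros Q B).ncard : ℝ) * r = X.card * r := by rw [hcard]
    _ ≤ n * (218 * r + 324) := by
        simpa only [Fintype.card_fin] using card_mul_le_of_fibers hclass
    _ ≤ 8 * constC Q χ w * (218 * r + 324) := by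
        gcongr
        exact_mod_cast hn

end Counting

section Bound

variable {Q : MvPolynomial (Fin 3) ℤ} {N : ℕ} {χ : DirichletCharacter ℤ N}

lemma ncard_primitiveZeros_le_of_pow_eq (hQ : Q.IsHomogeneous 2) (hΔ : discr Q ≠ 0)
    (hiso : IsIsotropic Q) (hχ : IsAssocCharacter Q χ) (w : ℝ) {B : Fin 3 → ℝ}
    (hB : ∀ i, 0 < B i) {v d δ : ℝ} (hv₀ : 0 < v) (hd₀ : 0 < d) (hδ₀ : 0 < δ)
    (hv : v ^ 3 = B 0 * B 1 * B 2) (hd : d ^ 2 = minorGcd Q) (hδ : δ ^ 3 = |(discr Q : ℝ)|) :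
    ((primitiveZeros Q B).ncard : ℝ) ≤ 8 * 324 * 2 ^ 4 * constC Q χ w * (1 + v * d / δ) := by
  have hr : 0 < δ / (2 ^ 4 * d * v) := by positivity
  have hrB : ((δ / (2 ^ 4 * d * v)) ^ 3 * (B 0 * B 1 * B 2)) ^ 2 * (2 ^ 8 * minorGcd Q) ^ 3 ≤
      (discr Q : ℝ) ^ 2 := by
    rw [← sq_abs (discr Q : ℝ), ← hδ, ← hv, ← hd]
    refine le_of_eq ?_
    field_simp
  have hC : (0 : ℝ) ≤ constC Q χ w := by exact_mod_cast constC_nonneg hQ hΔ hχ w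
  refine le_of_mul_le_mul_right ?_ hr
  calc ((primitiveZeros Q B).ncard : ℝ) * (δ / (2 ^ 4 * d * v))
      ≤ 8 * constC Q χ w * (218 * (δ / (2 ^ 4 * d * v)) + 324) :=
        ncard_primitiveZeros_mul_le hQ hΔ hiso hχ w hB hr hrB
    _ ≤ 8 * constC Q χ w * (324 * 2 ^ 4 * (δ / (2 ^ 4 * d * v)) + 324) := by
        gcongr
        norm_num
    _ = 8 * 324 * 2 ^ 4 * constC Q χ w * (1 + v * d / δ) * (δ / (2 ^ 4 * d * v)) := by
        field_simp

end Bound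

end TernaryForm

theorem lemma2p4 :
    ∃ c : ℝ, 0 < c ∧
      ∀ Q : MvPolynomial (Fin 3) ℤ, Q.IsHomogeneous 2 → TernaryForm.discr Q ≠ 0 →
        TernaryForm.IsIsotropic Q →
        (∃ (N : ℕ) (_ : NeZero N) (χ : DirichletCharacter ℤ N),
            TernaryForm.IsAssocCharacter Q χ) ∧
        ∀ (N : ℕ) [NeZero N] (χ : DirichletCharacter ℤ N), TernaryForm.IsAssocCharacter Q χ →
          ∀ (w B₁ B₂ B₃ : ℝ), 0 < w → 0 < B₁ → 0 < B₂ → 0 < B₃ →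
            ((TernaryForm.primitiveZeros Q ![B₁, B₂, B₃]).ncard : ℝ) ≤
              c * (TernaryForm.constC Q χ w : ℝ) *
                (1 + (B₁ * B₂ * B₃) ^ (1 / 3 : ℝ) * (TernaryForm.minorGcd Q : ℝ) ^ (1 / 2 : ℝ) /
                  |(TernaryForm.discr Q : ℝ)| ^ (1 / 3 : ℝ)) := by
  refine ⟨8 * 324 * 2 ^ 4, by norm_num, fun Q hQ hΔ hiso =>
    ⟨TernaryForm.exists_isAssocCharacter hQ hΔ, fun N _ χ hχ w B₁ B₂ B₃ _ h₁ h₂ h₃ => ?_⟩⟩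
  have hB : ∀ i, 0 < ![B₁, B₂, B₃] i := Fin.forall_fin_succ.2
    ⟨h₁, Fin.forall_fin_succ.2 ⟨h₂, Fin.forall_fin_succ.2 ⟨h₃, fun i => i.elim0⟩⟩⟩
  have hV : 0 < B₁ * B₂ * B₃ := by positivity
  have hD : (0 : ℝ) < TernaryForm.minorGcd Q := by
    exact_mod_cast Nat.pos_of_ne_zero (TernaryForm.minorGcd_ne_zero hΔ)
  have hΔ₀ : 0 < |(TernaryForm.discr Q : ℝ)| := abs_pos.2 (Int.cast_ne_zero.2 hΔ)
  simp only [one_div]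
  exact TernaryForm.ncard_primitiveZeros_le_of_pow_eq hQ hΔ hiso hχ w hB
    (Real.rpow_pos_of_pos hV _) (Real.rpow_pos_of_pos hD _) (Real.rpow_pos_of_pos hΔ₀ _)
    (Real.rpow_inv_natCast_pow hV.le three_ne_zero)
    (Real.rpow_inv_natCast_pow hD.le two_ne_zero)
    (Real.rpow_inv_natCast_pow hΔ₀.le three_ne_zero)
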